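/- Consider $\min_{x\in\mathbb R^n} f(x)$ and the following trust-region Newton-CG method, with inputs $\epsilon_g,\epsilon_H>0$, $\gamma_1\in(0,1)$, $\gamma_2\ge 1$, $\psi\in(1/\gamma_2,1]$, $x_0\in\mathbb R^n$, $0<\delta_0\le\delta_{\max}$, $\eta,\zeta\in(0,1)$, a flag capCG, and $M\ge L_g$. Write $g_k=\nabla f(x_k)$, $H_k=\nabla^2 f(x_k)$ and $m_k(x)=f(x_k)+g_k^T(x-x_k)+\frac12(x-x_k)^TH_k(x-x_k)$. In iteration $k=0,1,2,\dots$: 1. If $g_k\neq0$, run truncated CG on $A=H_k+2\epsilon_H I$: set $k_{\max}=n$ if capCG is false and $k_{\max}=\min\{n,J\}$ if capCG is true, where $J=\frac12\sqrt{\kappa}\,\ln(4\kappa^{3/2}/\zeta)$ and $\kappa=(M+2\epsilon_H)/\epsilon_H$. Set $y_0=0$, $r_0=g_k$, $p_0=-g_k$. For $j=0,1,2,\dots$ while $j<k_{\max}$: if $p_j^TAp_j\le\epsilon_H\|p_j\|^2$, return $y_j+\sigma p_j$ with $\sigma\ge0$ and $\|y_j+\sigma p_j\|=\delta_k$ (flag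 BND-NEG); set $\alpha_j=\|r_j\|^2/(p_j^TAp_j)$ and $y_{j+1}=y_j+\alpha_jp_j$; if $\|y_{j+1}\|\ge\delta_k$, return $y_j+\sigma p_j$ with $\sigma\ge0$ and $\|y_j+\sigma p_j\|=\delta_k$ (BND-NORM); set $r_{j+1}=r_j+\alpha_jAp_j$; if $\|r_{j+1}\|\le\frac{\zeta}{2}\min\{\|g_k\|,\epsilon_H\|y_{j+1}\|\}$, return $y_{j+1}$ (INT-RES); set $p_{j+1}=-r_{j+1}+(\|r_{j+1}\|^2/\|r_j\|^2)p_j$. When the loop ends, return the last $y_j$ (INT-MAX). Each pass of the loop uses one Hessian-vector product. If $g_k=0$, the CG step is $0$ with flag INT-RES. 2. If the flag is BND-NEG or BND-NORM, or it is INT-RES and $\|g_k\|>\epsilon_g$, let $s_k$ be the CG step. Otherwise, if a direction $v$ is stored, use it; if not, call a (randomized) minimum eigenvalue oracle, which either indicates that $H_k\succeq-\epsilon_HI$, in which case the method terminates and returns $x_k$, or computes $v$ with $\|v\|=1$ and $v^TH_kv\le-\epsilon_H/2$. Let $s_k=\pm\delta_kv$ with $g_k^Ts_k\le0$. 3. Let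 $\rho_k=(f(x_k)-f(x_k+s_k))/(m_k(x_k)-m_k(x_k+s_k))$. If $\rho_k\ge\eta$ (a successful iteration), set $x_{k+1}=x_k+s_k$, discard any stored direction, and set $\delta_{k+1}=\min\{\gamma_2\delta_k,\delta_{\max}\}$ if $\|s_k\|\ge\psi\delta_k$ and $\delta_{k+1}=\delta_k$ otherwise. If $\rho_k<\eta$, set $x_{k+1}=x_k$, $\delta_{k+1}=\gamma_1\|s_k\|$, and, if $s_k=\pm\delta_kv$ comes from an oracle call in this iteration, store $v$. Let $\mathcal K$ be the set of iterations completed without termination. Assume for the run that $f(x_k)\ge f_{\rm low}$ for every iterate, that the iterates and the segments $[x_k,x_k+s_k]$ lie in an open set on which $f$ is twice continuously differentiable with $\nabla f$ and $\nabla^2f$ Lipschitz continuous with constants $L_g,L_H\in(0,\infty)$, and that every oracle call uses at most $N_{\rm meo}=\min\{n,1+\lceil C_{\rm meo}\epsilon_H^{-1/2}\rceil\}$ Hessian-vector products, where $C_{\rm meo}\ge0$. Put $$\bar K_{\mathcal S}=\Big\lfloor\tfrac{8(f(x_0)-f_{\rm low})}{\eta}\max\Big\{\tfrac1{\delta_0^2},\tfrac{4L_H^2}{9\gamma_1^2(1-\eta)^2},7+2L_H\Big\}\max\{\epsilon_H^{-1},\epsilon_g^{-2}\epsilon_H,\epsilon_H^{-3}\}\Big\rfloor+1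 .$$ **Theorem.** Let $\epsilon_g\in(0,1)$ and $\epsilon_H=\epsilon_g^{1/2}$. Then every realization of a run terminates, and the total number of Hessian-vector products in CG and in the oracle, the terminating iteration included, satisfies: (i) if capCG is false, it is at most $n(|\mathcal K|+1)+N_{\rm meo}\bar K_{\mathcal S}$, and this bound is at most $n\,C\,\epsilon_g^{-3/2}(1+|\log\epsilon_g^{-3/2}|)^c$, i.e. $n\,\tilde{\mathcal O}(\epsilon_g^{-3/2})$; (ii) if capCG is true, it is at most $\min\{n,\lceil J\rceil\}(|\mathcal K|+1)+N_{\rm meo}\bar K_{\mathcal S}$, and this bound is at most $\min\{n,\epsilon_g^{-1/4}\}\,C(1+C_{\rm meo})\,\epsilon_g^{-3/2}(1+|\log\epsilon_g^{-3/2}|)^c$, i.e. $\min\{n,\epsilon_g^{-1/4}\}\,\tilde{\mathcal O}(\epsilon_g^{-3/2})$; in particular the number of products is at most $C(1+C_{\rm meo})\,\epsilon_g^{-7/4}(1+|\log\epsilon_g^{-7/4}|)^c$, i.e. $\tilde{\mathcal O}(\epsilon_g^{-7/4})$, independently of $n$. Here $C,c>0$ depend only on the algorithm's parameters $\gamma_1,\gamma_2,\psi,\delta_0,\delta_{\max},\eta,\zeta,\text{capCG},M$,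 on $L_g,L_H$, and on an upper bound for $f(x_0)-f_{\rm low}$; they do not depend on $n$, $f$, $x_0$, $\epsilon_g$, $C_{\rm meo}$, the failure probability of the oracle, or the realization. -/

import Mathlib

open scoped NNReal

namespace TRNewtonCG

noncomputable section

/-- `ℝⁿ` with the Euclidean norm. -/
abbrev Vec (n : ℕ) := EuclideanSpace ℝ (Fin n)

/-- The Hessian `∇²f(x)`, as a linear operator on `ℝⁿ`. -/
def hess {n : ℕ} (f : Vec n → ℝ) (x : Vec n) : Vec n →L[ℝ] Vec n :=
  fderiv ℝ (gradient f) x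

/-- The quadratic model `m(z) = f(x) + g(x)ᵀ(z - x) + ½ (z - x)ᵀ H(x) (z - x)` of `f` at `x`. -/
def model {n : ℕ} (f : Vec n → ℝ) (x z : Vec n) : ℝ :=
  f x + inner ℝ (gradient f x) (z - x) + 1 / 2 * inner ℝ (z - x) (hess f x (z - x))

/-- The ratio of actual to predicted decrease for the trial step `s` at `x`. -/
def ratio {n : ℕ} (f : Vec n → ℝ) (x s : Vec n) : ℝ :=
  (f x - f (x + s)) / (model f x x - model f x (x + s))

/-! ### Truncated conjugate gradient method -/

/-- `κ(M, ε) = (M + 2ε) / ε`. -/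
def kappa (M ε : ℝ) : ℝ := (M + 2 * ε) / ε

/-- `J(M, ε, ζ) = ½ √κ ln(4 κ^{3/2} / ζ)`. -/
def capJ (M ε ζ : ℝ) : ℝ :=
  1 / 2 * √(kappa M ε) * Real.log (4 * kappa M ε ^ (3 / 2 : ℝ) / ζ)

/-- The iteration limit `k_max`: `min{n, J(M, ε, ζ)}` with the cap and `n` without it. -/
def kMax (capCG : Bool) (n : ℕ) (M ε ζ : ℝ) : ℝ :=
  if capCG = true then min (n : ℝ) (capJ M ε ζ) else n

/-- The quantities `y_j, r_j, p_j` carried by the conjugate gradient method. -/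
structure CGState (n : ℕ) where
  y : Vec n
  r : Vec n
  p : Vec n

/-- The shifted operator `H + 2 ε I`. -/
def shifted {n : ℕ} (H : Vec n →L[ℝ] Vec n) (ε : ℝ) : Vec n →L[ℝ] Vec n :=
  H + (2 * ε) • ContinuousLinearMap.id ℝ (Vec n)

/-- One pass of the conjugate gradient recursion for the operator `A`. -/
def CGState.next {n : ℕ} (A : Vec n →L[ℝ] Vec n) (c : CGState n) : CGState n :=
  let α : ℝ := ‖c.r‖ ^ 2 / inner ℝ c.p (A c.p)
  let r' : Vec n := c.r + α • A c.p
  let β : ℝ := ‖r'‖ ^ 2 / ‖c.r‖ ^ 2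
  ⟨c.y + α • c.p, r', -r' + β • c.p⟩

/-- The conjugate gradient iterates, from `y₀ = 0`, `r₀ = g`, `p₀ = -g`. They are used below only
up to the pass in which the method returns. -/
def cgIter {n : ℕ} (g : Vec n) (A : Vec n →L[ℝ] Vec n) : ℕ → CGState n
  | 0 => ⟨0, g, -g⟩
  | j + 1 => (cgIter g A j).next A

/-- The output flag `outCG`. -/
inductive OutCG
  | bndNeg
  | bndNorm
  | intRes
  | intMax

section CG

variable {n : ℕ} (g : Vec n) (H : Vec n →L[ℝ] Vec n) (ε δ ζ : ℝ)

/-- The curvature test of pass `j`: `p_jᵀ (H + 2εI) p_j ≤ ε ‖p_j‖²`. -/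
def negTest (j : ℕ) : Prop :=
  inner ℝ (cgIter g (shifted H ε) j).p (shifted H ε (cgIter g (shifted H ε) j).p)
    ≤ ε * ‖(cgIter g (shifted H ε) j).p‖ ^ 2

/-- The radius test of pass `j`: `‖y_{j+1}‖ ≥ δ`. -/
def normTest (j : ℕ) : Prop := δ ≤ ‖(cgIter g (shifted H ε) (j + 1)).y‖

/-- The residual test of pass `j`: `‖r_{j+1}‖ ≤ (ζ/2) min{‖g‖, ε ‖y_{j+1}‖}`. -/
def resTest (j : ℕ) : Prop :=
  ‖(cgIter g (shifted H ε) (j + 1)).r‖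
    ≤ ζ / 2 * min ‖g‖ (ε * ‖(cgIter g (shifted H ε) (j + 1)).y‖)

/-- Pass `j` of the loop is entered, and no earlier pass has returned. -/
def entersPass (kmax : ℝ) (j : ℕ) : Prop :=
  (j : ℝ) < kmax ∧
    ∀ i < j, ¬ negTest g H ε i ∧ ¬ normTest g H ε δ i ∧ ¬ resTest g H ε ζ i

/-- `CGReturns g H ε δ ζ kmax s out m`: the truncated CG method with these inputs and
iteration limit `kmax` returns the step `s` and the flag `out` after `m` passes of its loop.
A pass needs exactly one product with `H`, namely `H p_j`, so `m` is also the number of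
Hessian-vector products. -/
inductive CGReturns (kmax : ℝ) : Vec n → OutCG → ℕ → Prop
  | bndNeg (j : ℕ) (σ : ℝ) (hj : entersPass g H ε δ ζ kmax j) (hneg : negTest g H ε j)
      (hσ : 0 ≤ σ)
      (hs : ‖(cgIter g (shifted H ε) j).y + σ • (cgIter g (shifted H ε) j).p‖ = δ) :
      CGReturns kmax ((cgIter g (shifted H ε) j).y + σ • (cgIter g (shifted H ε) j).p)
        OutCG.bndNeg (j + 1)
  | bndNorm (j : ℕ) (σ : ℝ) (hj : entersPass g H ε δ ζ kmax j) (hneg : ¬ negTest g H ε j)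
      (hnorm : normTest g H ε δ j) (hσ : 0 ≤ σ)
      (hs : ‖(cgIter g (shifted H ε) j).y + σ • (cgIter g (shifted H ε) j).p‖ = δ) :
      CGReturns kmax ((cgIter g (shifted H ε) j).y + σ • (cgIter g (shifted H ε) j).p)
        OutCG.bndNorm (j + 1)
  | intRes (j : ℕ) (hj : entersPass g H ε δ ζ kmax j) (hneg : ¬ negTest g H ε j)
      (hnorm : ¬ normTest g H ε δ j) (hres : resTest g H ε ζ j) :
      CGReturns kmax (cgIter g (shifted H ε) (j + 1)).y OutCG.intRes (j + 1)
  | intMax (m : ℕ) (hm : kmax ≤ m)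
      (hpass : ∀ j < m, entersPass g H ε δ ζ kmax j ∧
        ¬ negTest g H ε j ∧ ¬ normTest g H ε δ j ∧ ¬ resTest g H ε ζ j) :
      CGReturns kmax (cgIter g (shifted H ε) m).y OutCG.intMax m

end CG

/-! ### Minimum eigenvalue oracle -/

/-- A direction that the oracle may compute: `‖v‖ = 1` and `vᵀ H v ≤ -ε/2`. -/
def IsNegCurvDir {n : ℕ} (H : Vec n →L[ℝ] Vec n) (ε : ℝ) (v : Vec n) : Prop :=
  ‖v‖ = 1 ∧ inner ℝ v (H v) ≤ -ε / 2

/-- `s = ± δ v` with the sign such that `gᵀ s ≤ 0`. -/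
def IsScaledStep {n : ℕ} (g : Vec n) (δ : ℝ) (v s : Vec n) : Prop :=
  (s = δ • v ∨ s = -(δ • v)) ∧ inner ℝ g s ≤ 0

/-! ### Trust-region Newton-CG method -/

/-- The inputs of the trust-region method, other than `ε_g`, `ε_H` and `x₀`. -/
structure Params where
  γ₁ : ℝ
  γ₂ : ℝ
  ψ : ℝ
  δ₀ : ℝ
  δmax : ℝ
  η : ℝ
  ζ : ℝ
  capCG : Bool
  M : ℝ
  γ₁_pos : 0 < γ₁
  γ₁_lt : γ₁ < 1
  one_le_γ₂ : 1 ≤ γ₂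
  lt_ψ : 1 / γ₂ < ψ
  ψ_le : ψ ≤ 1
  δ₀_pos : 0 < δ₀
  δ₀_le : δ₀ ≤ δmax
  η_pos : 0 < η
  η_lt : η < 1
  ζ_pos : 0 < ζ
  ζ_lt : ζ < 1

/-- What the method carries from one iteration to the next: the iterate, the radius, and the
negative curvature direction stored since the last successful iteration, if there is one. -/
structure State (n : ℕ) where
  x : Vec n
  δ : ℝ
  stored : Option (Vec n)

section Method

variable {n : ℕ} (f : Vec n → ℝ) (P : Params) (εg εH : ℝ)

/-- The CG phase of an iteration: its step, its flag and its number of Hessian-vector products.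
CG is called if the gradient is not zero. -/
inductive CGPhase (S : State n) : Vec n → OutCG → ℕ → Prop
  | call (s : Vec n) (out : OutCG) (m : ℕ) (hg : gradient f S.x ≠ 0)
      (h : CGReturns (gradient f S.x) (hess f S.x) εH S.δ P.ζ (kMax P.capCG n P.M εH P.ζ)
        s out m) : CGPhase S s out m
  | skip (hg : gradient f S.x = 0) : CGPhase S 0 OutCG.intRes 0

/-- The CG step is taken as the trial step; otherwise a direction of negative curvature is
asked for. -/
def usesCG (x : Vec n) (out : OutCG) : Prop :=
  out = OutCG.bndNeg ∨ out = OutCG.bndNorm ∨ (εg < ‖gradient f x‖ ∧ out = OutCG.intRes)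

/-- `TrialStep f P εg εH S s w a b`: an iteration that starts in `S` computes the trial step `s`
with `a` Hessian-vector products in CG and `b` in the oracle; `w` is the negative curvature
direction available after that. The oracle is called only if no direction is stored. The oracle
is randomized; the relation allows each of its possible answers. -/
inductive TrialStep (S : State n) : Vec n → Option (Vec n) → ℕ → ℕ → Prop
  | cg (s : Vec n) (out : OutCG) (a : ℕ) (hcg : CGPhase f P εH S s out a)
      (hout : usesCG f εg S.x out) : TrialStep S s S.stored a 0
  | oracle (sCG : Vec n) (out : OutCG) (v s : Vec n) (a b : ℕ)
      (hcg : CGPhase f P εH S sCG out a) (hout : ¬ usesCG f εg S.x out)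
      (hnone : S.stored = none) (hv : IsNegCurvDir (hess f S.x) εH v)
      (hs : IsScaledStep (gradient f S.x) S.δ v s) : TrialStep S s (some v) a b
  | stored (sCG : Vec n) (out : OutCG) (v s : Vec n) (a : ℕ)
      (hcg : CGPhase f P εH S sCG out a) (hout : ¬ usesCG f εg S.x out)
      (hsome : S.stored = some v)
      (hs : IsScaledStep (gradient f S.x) S.δ v s) : TrialStep S s (some v) a 0

/-- The iteration that starts in `S` ends the method: the oracle is called and indicates
`H ⪰ -ε_H I`, whether or not this is so. -/
inductive Terminates (S : State n) : ℕ → ℕ → Prop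
  | intro (sCG : Vec n) (out : OutCG) (a b : ℕ)
      (hcg : CGPhase f P εH S sCG out a) (hout : ¬ usesCG f εg S.x out)
      (hnone : S.stored = none) : Terminates S a b

/-- The next state, after the trial step `s` was computed and with `w` the available direction of
negative curvature. After a successful iteration nothing is stored. -/
def State.update (S : State n) (s : Vec n) (w : Option (Vec n)) : State n :=
  if P.η ≤ ratio f S.x s then
    ⟨S.x + s, if P.ψ * S.δ ≤ ‖s‖ then min (P.γ₂ * S.δ) P.δmax else S.δ, none⟩
  else
    ⟨S.x, P.γ₁ * ‖s‖, w⟩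

/-- A realization of a run of the trust-region Newton-CG method in which computed directions of
negative curvature are kept until the next successful iteration. `len` is the number of
iterations completed without termination, `⊤` if the method never terminates; if it is finite,
then iteration number `len` is the one in which the method terminates. The values of the
sequences at later indices have no meaning. -/
structure Run (x₀ : Vec n) where
  len : ℕ∞
  state : ℕ → State n
  s : ℕ → Vec n
  cgProducts : ℕ → ℕ
  oracleProducts : ℕ → ℕ
  init : state 0 = ⟨x₀, P.δ₀, none⟩
  step : ∀ k : ℕ, (k : ℕ∞) < len → ∃ w : Option (Vec n),
    TrialStep f P εg εH (state k) (s k) w (cgProducts k) (oracleProducts k) ∧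
      state (k + 1) = (state k).update f P (s k) w
  last : ∀ k : ℕ, (k : ℕ∞) = len →
    Terminates f P εg εH (state k) (cgProducts k) (oracleProducts k)

end Method

section Assumptions

variable {n : ℕ} {f : Vec n → ℝ} {P : Params} {εg εH : ℝ} {x₀ : Vec n}

/-- The number of Hessian-vector products in the iterations `0, …, N`. -/
def Run.products (R : Run f P εg εH x₀) (N : ℕ) : ℕ :=
  ∑ k ∈ Finset.range (N + 1), (R.cgProducts k + R.oracleProducts k)

/-- The assumption on the objective: its values at the iterates are at least `flow`, and the
iterates and the segments `[x_k, x_k + s_k]` lie in an open set on which `f` is twice continuously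
differentiable with `Lg`-Lipschitz gradient and `LH`-Lipschitz Hessian. -/
structure Run.ObjectiveAssumption (R : Run f P εg εH x₀) (flow : ℝ) (Lg LH : ℝ≥0) : Prop where
  lower : ∀ k : ℕ, (k : ℕ∞) ≤ R.len → flow ≤ f (R.state k).x
  smooth : ∃ U : Set (Vec n), IsOpen U ∧
    (∀ k : ℕ, (k : ℕ∞) ≤ R.len → (R.state k).x ∈ U) ∧
    (∀ k : ℕ, (k : ℕ∞) < R.len → segment ℝ (R.state k).x ((R.state k).x + R.s k) ⊆ U) ∧
    ContDiffOn ℝ 2 f U ∧ LipschitzOnWith Lg (gradient f) U ∧ LipschitzOnWith LH (hess f) U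

/-- `N_meo(ε_H) = min{n, 1 + ⌈C_meo ε_H^{-1/2}⌉}`. -/
def Nmeo (n : ℕ) (Cmeo εH : ℝ) : ℕ := min n (1 + ⌈Cmeo * εH ^ (-(1 / 2) : ℝ)⌉₊)

/-- Every call of the oracle needs at most `N_meo(ε_H)` Hessian-vector products. -/
def Run.OracleAssumption (R : Run f P εg εH x₀) (Cmeo : ℝ) : Prop :=
  ∀ k : ℕ, (k : ℕ∞) ≤ R.len → R.oracleProducts k ≤ Nmeo n Cmeo εH

end Assumptions

/-- The constant in the bound on the number of successful iterations, with `Δ = f(x₀) - f_low`. -/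
def CbarS (P : Params) (LH : ℝ≥0) (Δ : ℝ) : ℝ :=
  8 * Δ / P.η *
    max (max (1 / P.δ₀ ^ 2) (4 * (LH : ℝ) ^ 2 / (9 * P.γ₁ ^ 2 * (1 - P.η) ^ 2)))
      (7 + 2 * (LH : ℝ))

/-- The bound `⌊C̄_S max{ε_H⁻¹, ε_g⁻² ε_H, ε_H⁻³}⌋ + 1` on the number of successful iterations. -/
def KbarS (P : Params) (LH : ℝ≥0) (Δ εg εH : ℝ) : ℕ :=
  ⌊CbarS P LH Δ * max (max εH⁻¹ ((εg ^ 2)⁻¹ * εH)) (εH ^ 3)⁻¹⌋₊ + 1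

/-- `C φ (1 + |log φ|)^c`, the form of a quantity that is `Õ(φ)`. -/
def softO (C c φ : ℝ) : ℝ := C * φ * (1 + |Real.log φ|) ^ c

end

end TRNewtonCG

open TRNewtonCG

/-!
The decrease of `f` in the iterations bounds the number of successful ones, and the trust-region
radii bound the unsuccessful ones in terms of these. No convergence theory for conjugate gradients
is needed: a CG call that runs into its iteration limit leads to a step along a direction of
negative curvature or to termination, so it suffices that each call makes at most `n`, respectively
`min{n, ⌈J⌉}`, passes.

*One iteration.* As long as CG meets positive curvature, its residuals are orthogonal, its
directions are conjugate for `A = H + 2 ε_H I`, and `y_jᵀ p_j ≥ 0` (`CGRelations`). Hence the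
shifted quadratic model does not increase up to the minimizer along `p_j`, and along a direction
with `pᵀ A p ≤ ε_H ‖p‖²` it rises by at most `½ ε_H ‖s‖²`. The shift `ε_H ‖s‖²` then leaves a
decrease of the model of at least `½ ε_H ‖s‖²`; a step along a direction of negative curvature
gives `¼ ε_H ‖s‖²` (`TrialStep.properties`). Since the model is exact up to `L_H/6 ‖s‖³`, a rejected
step has length at least a multiple of `ε_H`, so the radii never fall below `minRadius`, which is
of order `ε_H`.

*Successes.* A successful step to the boundary of the trust region therefore decreases `f` by
`minDecrease`, of order `ε_H³`. So does a successful interior CG step that ends at a point with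
gradient norm above `ε_g = ε_H²`, because the small CG residual and the Taylor bound for the
gradient keep its length above a multiple of `ε_H` (`StepProperties.minDecrease_le_or`). The remaining
successes go from a large gradient to a small one. At a small gradient no interior CG step is taken,
so the next success reaches the boundary; at least every second success is productive.

*Oracle calls.* The oracle is called at `x` only if the gradient is small or CG hit its iteration
limit. The residual test does not depend on the radius, so in both cases no interior CG step is
taken from `x` at any later radius. Hence a completed oracle call is followed, with its direction
stored until then, by a success that decreases `f` by `minDecrease`, and these calls are at most
`(f(x₀) - f_low) / minDecrease` in number. Both counts are kept as potentials in `Progress`.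

*Total.* Failures multiply the radius by at most `γ₁`, successes by at most `γ₂`, and the radius
stays above a multiple of `ε_H`, so there are at most `O(ε_H⁻³)` iterations, the logarithm of `1/ε_H`
being absorbed (`Run.exists_len_eq`). Finally `J = O(ε_H^{-1/2} (1 + |log ε_H⁻³|))` (`ceil_capJ_le`)
and `N_meo = O(ε_H^{-1/2})` (`Nmeo_le`), with `ε_H^{-1/2} = ε_g^{-1/4}`.
-/

namespace TRNewtonCG

/-! ### Conjugate gradient recursion -/

section ConjugateGradient

variable {n : ℕ} {g : Vec n} {A : Vec n →L[ℝ] Vec n}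

/-- The quadratic `q(y) = gᵀ y + ½ yᵀ A y` that the conjugate gradient method minimizes. -/
noncomputable def cgObjective (g : Vec n) (A : Vec n →L[ℝ] Vec n) (y : Vec n) : ℝ :=
  inner ℝ g y + 1 / 2 * inner ℝ y (A y)

/-- The step length `α_j` of the conjugate gradient method. -/
noncomputable def cgAlpha (g : Vec n) (A : Vec n →L[ℝ] Vec n) (j : ℕ) : ℝ :=
  ‖(cgIter g A j).r‖ ^ 2 / inner ℝ (cgIter g A j).p (A (cgIter g A j).p)

lemma cgIter_succ_y (j : ℕ) : (cgIter g A (j + 1)).y =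
    (cgIter g A j).y + cgAlpha g A j • (cgIter g A j).p := rfl

lemma cgIter_succ_r (j : ℕ) : (cgIter g A (j + 1)).r =
    (cgIter g A j).r + cgAlpha g A j • A (cgIter g A j).p := rfl

lemma cgIter_succ_p (j : ℕ) : (cgIter g A (j + 1)).p = -(cgIter g A (j + 1)).r +
    (‖(cgIter g A (j + 1)).r‖ ^ 2 / ‖(cgIter g A j).r‖ ^ 2) • (cgIter g A j).p := rfl

lemma cgIter_residual (j : ℕ) : (cgIter g A j).r = g + A (cgIter g A j).y := by
  induction j with
  | zero => simp [cgIter]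
  | succ j ih => rw [cgIter_succ_r, cgIter_succ_y, ih, map_add, map_smul, add_assoc]

/-- A vector orthogonal to `p_0, …, p_{j-1}` is orthogonal to `y_j`, which lies in their span. -/
lemma inner_cgIter_y_eq_zero {u : Vec n} {j : ℕ}
    (hu : ∀ i < j, inner ℝ u (cgIter g A i).p = 0) : inner ℝ u (cgIter g A j).y = 0 := by
  induction j with
  | zero => simp [cgIter]
  | succ j ih =>
    rw [cgIter_succ_y, inner_add_right, inner_smul_right, hu j (Nat.lt_succ_self j),
      ih fun i hi => hu i (hi.trans (Nat.lt_succ_self j)), mul_zero, add_zero]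

/-- A vector orthogonal to `p_0, …, p_j` is orthogonal to `r_j`, which lies in their span. -/
lemma inner_cgIter_r_eq_zero {u : Vec n} {j : ℕ}
    (hu : ∀ i ≤ j, inner ℝ u (cgIter g A i).p = 0) : inner ℝ u (cgIter g A j).r = 0 := by
  cases j with
  | zero => simpa [cgIter] using hu 0 le_rfl
  | succ j =>
    have h : (cgIter g A (j + 1)).r = (‖(cgIter g A (j + 1)).r‖ ^ 2 / ‖(cgIter g A j).r‖ ^ 2) •
        (cgIter g A j).p - (cgIter g A (j + 1)).p := by rw [cgIter_succ_p]; abel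
    rw [h, inner_sub_right, inner_smul_right, hu j (Nat.le_succ j), hu _ le_rfl, mul_zero, sub_zero]

lemma cgObjective_add_smul (hA : ∀ u v, inner ℝ (A u) v = inner ℝ u (A v)) (y p : Vec n) (t : ℝ) :
    cgObjective g A (y + t • p) = cgObjective g A y + t * inner ℝ (g + A y) p
      + 1 / 2 * t ^ 2 * inner ℝ p (A p) := by
  simp only [cgObjective, map_add, map_smul, inner_add_left, inner_add_right, inner_smul_left,
    inner_smul_right, RCLike.conj_to_real]
  rw [← hA y p, real_inner_comm p (A y)]
  ring

/-- The orthogonality and descent relations satisfied by the conjugate gradient quantities of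
index `j` as long as only directions of positive curvature and nonzero residuals were met. -/
structure CGRelations (g : Vec n) (A : Vec n →L[ℝ] Vec n) (j : ℕ) : Prop where
  inner_r_p : ∀ i < j, inner ℝ (cgIter g A j).r (cgIter g A i).p = 0
  conjugate : ∀ i < j, inner ℝ (cgIter g A j).p (A (cgIter g A i).p) = 0
  inner_r_p_self : inner ℝ (cgIter g A j).r (cgIter g A j).p = -‖(cgIter g A j).r‖ ^ 2
  inner_y_p_nonneg : 0 ≤ inner ℝ (cgIter g A j).y (cgIter g A j).p
  objective_nonpos : cgObjective g A (cgIter g A j).y ≤ 0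

lemma cgRelations_zero : CGRelations g A 0 where
  inner_r_p := by simp
  conjugate := by simp
  inner_r_p_self := by simp [cgIter]
  inner_y_p_nonneg := by simp [cgIter]
  objective_nonpos := by simp [cgIter, cgObjective]

/-- Along `p_j` the objective falls on `[0, α_j]`. -/
lemma CGRelations.objective_add_smul_nonpos (hA : ∀ u v, inner ℝ (A u) v = inner ℝ u (A v))
    {j : ℕ} (h : CGRelations g A j) (hp : 0 < inner ℝ (cgIter g A j).p (A (cgIter g A j).p))
    {t : ℝ} (ht : 0 ≤ t) (htα : t ≤ cgAlpha g A j) :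
    cgObjective g A ((cgIter g A j).y + t • (cgIter g A j).p) ≤ 0 := by
  rw [cgObjective_add_smul hA, ← cgIter_residual, h.inner_r_p_self]
  have h1 := h.objective_nonpos
  rw [cgAlpha, le_div_iff₀ hp] at htα
  nlinarith [mul_le_mul_of_nonneg_left htα ht, mul_nonneg ht (sq_nonneg ‖(cgIter g A j).r‖)]

lemma CGRelations.succ (hA : ∀ u v, inner ℝ (A u) v = inner ℝ u (A v)) {j : ℕ}
    (hprev : ∀ i ≤ j, CGRelations g A i)
    (hp : ∀ i ≤ j, 0 < inner ℝ (cgIter g A i).p (A (cgIter g A i).p))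
    (hr : ∀ i ≤ j, (cgIter g A i).r ≠ 0) : CGRelations g A (j + 1) := by
  have h := hprev j le_rfl
  have hα : ∀ i ≤ j, 0 < cgAlpha g A i := fun i hi =>
    div_pos (pow_pos (norm_pos_iff.2 (hr i hi)) 2) (hp i hi)
  have hrj : ‖(cgIter g A j).r‖ ^ 2 ≠ 0 := pow_ne_zero 2 (norm_ne_zero_iff.2 (hr j le_rfl))
  have hαj : cgAlpha g A j * inner ℝ (cgIter g A j).p (A (cgIter g A j).p)
      = ‖(cgIter g A j).r‖ ^ 2 := div_mul_cancel₀ _ (hp j le_rfl).ne'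
  have hrp : ∀ i < j + 1, inner ℝ (cgIter g A (j + 1)).r (cgIter g A i).p = 0 := by
    intro i hi
    rw [cgIter_succ_r, inner_add_left, inner_smul_left, hA, RCLike.conj_to_real]
    rcases (Nat.lt_succ_iff.1 hi).lt_or_eq with hij | rfl
    · rw [h.inner_r_p i hij, h.conjugate i hij, mul_zero, add_zero]
    · rw [h.inner_r_p_self, hαj, neg_add_cancel]
  have hrr : ∀ i < j + 1, inner ℝ (cgIter g A (j + 1)).r (cgIter g A i).r = 0 := fun i hi =>
    inner_cgIter_r_eq_zero fun l hl => hrp l (hl.trans_lt hi)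
  -- `A p_i` is a multiple of `r_{i+1} - r_i`, so residual orthogonality gives conjugacy.
  have hrA : ∀ i ≤ j, cgAlpha g A i * inner ℝ (cgIter g A (j + 1)).r (A (cgIter g A i).p)
      = inner ℝ (cgIter g A (j + 1)).r (cgIter g A (i + 1)).r := by
    intro i hi
    rw [cgIter_succ_r i, inner_add_right, inner_smul_right, hrr i (Nat.lt_succ_of_le hi), zero_add]
  have hyp : 0 ≤ inner ℝ (cgIter g A (j + 1)).y (cgIter g A j).p := by
    rw [cgIter_succ_y, inner_add_left, inner_smul_left, RCLike.conj_to_real,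
      real_inner_self_eq_norm_sq]
    have := mul_nonneg (hα j le_rfl).le (sq_nonneg ‖(cgIter g A j).p‖)
    linarith [h.inner_y_p_nonneg]
  refine ⟨hrp, fun i hi => ?_, ?_, ?_, ?_⟩
  · have hi' := Nat.lt_succ_iff.1 hi
    rw [cgIter_succ_p, inner_add_left, inner_neg_left, inner_smul_left, RCLike.conj_to_real]
    rcases hi'.lt_or_eq with hij | rfl
    · have h1 := hrA i hi'
      rw [hrr (i + 1) (Nat.succ_lt_succ hij), mul_eq_zero, or_iff_right (hα i hi').ne'] at h1
      rw [h1, h.conjugate i hij, neg_zero, mul_zero, add_zero]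
    · have h1 := hrA i le_rfl
      rw [real_inner_self_eq_norm_sq] at h1
      have h2 : inner ℝ (cgIter g A i).p (A (cgIter g A i).p)
          = ‖(cgIter g A i).r‖ ^ 2 / cgAlpha g A i := by
        rw [eq_div_iff (hα i le_rfl).ne', mul_comm, hαj]
      rw [← h1, h2]
      have := (hα i le_rfl).ne'
      rw [div_mul_div_comm, mul_comm (‖(cgIter g A i).r‖ ^ 2), mul_div_mul_right _ _ hrj,
        mul_div_cancel_left₀ _ this, neg_add_cancel]
  · rw [cgIter_succ_p, inner_add_right, inner_neg_right, inner_smul_right,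
      hrp j (Nat.lt_succ_self j), mul_zero, add_zero, real_inner_self_eq_norm_sq]
  · rw [cgIter_succ_p, inner_add_right, inner_neg_right, inner_smul_right,
      real_inner_comm _ (cgIter g A (j + 1)).y, inner_cgIter_y_eq_zero hrp, neg_zero, zero_add]
    exact mul_nonneg (by positivity) hyp
  · exact h.objective_add_smul_nonpos hA (hp j le_rfl) (hα j le_rfl).le le_rfl

lemma cgRelations_of_pos (hA : ∀ u v, inner ℝ (A u) v = inner ℝ u (A v)) {j : ℕ}
    (hp : ∀ i < j, 0 < inner ℝ (cgIter g A i).p (A (cgIter g A i).p))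
    (hr : ∀ i < j, (cgIter g A i).r ≠ 0) : CGRelations g A j := by
  induction j using Nat.strong_induction_on with
  | _ j ih =>
    cases j with
    | zero => exact cgRelations_zero
    | succ j =>
      exact CGRelations.succ hA
        (fun i hi => ih i (Nat.lt_succ_of_le hi) (fun l hl => hp l (by omega))
          (fun l hl => hr l (by omega)))
        (fun i hi => hp i (by omega)) (fun i hi => hr i (by omega))

end ConjugateGradient

/-! ### Outcomes of truncated conjugate gradients -/

section TruncatedCG

variable {n : ℕ} {g : Vec n} {H : Vec n →L[ℝ] Vec n} {ε δ ζ kmax : ℝ}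

/-- The decrease `-(gᵀ s + ½ sᵀ H s)` of the quadratic model along `s`. -/
noncomputable def modelDecrease (g : Vec n) (H : Vec n →L[ℝ] Vec n) (s : Vec n) : ℝ :=
  -(inner ℝ g s + 1 / 2 * inner ℝ s (H s))

lemma shifted_symm (hH : ∀ u v, inner ℝ (H u) v = inner ℝ u (H v)) (ε : ℝ) (u v : Vec n) :
    inner ℝ (shifted H ε u) v = inner ℝ u (shifted H ε v) := by
  simp [shifted, inner_add_left, inner_add_right, inner_smul_left, inner_smul_right, hH]

lemma modelDecrease_eq (s : Vec n) :
    modelDecrease g H s = ε * ‖s‖ ^ 2 - cgObjective g (shifted H ε) s := by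
  simp [modelDecrease, cgObjective, shifted, inner_add_right, inner_smul_right]
  ring

lemma shifted_inner_pos (hε : 0 ≤ ε) {j : ℕ} (h : ¬ negTest g H ε j) :
    0 < inner ℝ (cgIter g (shifted H ε) j).p (shifted H ε (cgIter g (shifted H ε) j).p) :=
  lt_of_le_of_lt (by positivity) (not_le.1 h)

/-- Inside the loop no residual vanishes, because a zero residual passes the residual test. -/
lemma cgIter_r_ne_zero (hg : g ≠ 0) (hε : 0 ≤ ε) (hζ : 0 ≤ ζ) {j : ℕ}
    (h : ∀ i < j, ¬ resTest g H ε ζ i) : (cgIter g (shifted H ε) j).r ≠ 0 := by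
  cases j with
  | zero => exact hg
  | succ j =>
    intro h0
    refine h j (Nat.lt_succ_self j) ?_
    rw [resTest, h0, norm_zero]
    positivity

lemma entersPass.cgRelations (hH : ∀ u v, inner ℝ (H u) v = inner ℝ u (H v)) (hg : g ≠ 0)
    (hε : 0 ≤ ε) (hζ : 0 ≤ ζ) {j : ℕ} (h : entersPass g H ε δ ζ kmax j) :
    CGRelations g (shifted H ε) j :=
  cgRelations_of_pos (shifted_symm hH ε) (fun i hi => shifted_inner_pos hε (h.2 i hi).1)
    fun _ hi => cgIter_r_ne_zero hg hε hζ fun l hl => (h.2 l (hl.trans hi)).2.2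

/-- Moving from `y` along `p` with `yᵀ p ≥ 0`, the distance from the origin grows. -/
lemma norm_add_smul_sq_ge {y p : Vec n} (h : 0 ≤ inner ℝ y p) {t : ℝ} (ht : 0 ≤ t) :
    t ^ 2 * ‖p‖ ^ 2 ≤ ‖y + t • p‖ ^ 2 := by
  rw [norm_add_sq_real, inner_smul_right, norm_smul, mul_pow, Real.norm_eq_abs, sq_abs]
  nlinarith [mul_nonneg ht h, sq_nonneg ‖y‖]

/-- A step returned on the boundary of the trust region decreases the model by `½ ε ‖s‖²`. On a
direction of small curvature the shifted objective may rise, but by at most `½ ε ‖s‖²`. -/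
lemma boundary_modelDecrease (hH : ∀ u v, inner ℝ (H u) v = inner ℝ u (H v)) (hg : g ≠ 0)
    (hε : 0 < ε) (hζ : 0 ≤ ζ) {j : ℕ} (hj : entersPass g H ε δ ζ kmax j)
    (htest : negTest g H ε j ∨ normTest g H ε δ j) {σ : ℝ} (hσ : 0 ≤ σ)
    (hs : ‖(cgIter g (shifted H ε) j).y + σ • (cgIter g (shifted H ε) j).p‖ = δ) :
    1 / 2 * ε * δ ^ 2 ≤ modelDecrease g H
      ((cgIter g (shifted H ε) j).y + σ • (cgIter g (shifted H ε) j).p) := by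
  have h := hj.cgRelations hH hg hε.le hζ
  have hr : (cgIter g (shifted H ε) j).r ≠ 0 :=
    cgIter_r_ne_zero hg hε.le hζ fun l hl => (hj.2 l hl).2.2
  have hsq := norm_add_smul_sq_ge h.inner_y_p_nonneg hσ
  rw [modelDecrease_eq (ε := ε), hs]
  rw [hs] at hsq
  by_cases hneg : negTest g H ε j
  · rw [cgObjective_add_smul (shifted_symm hH ε), ← cgIter_residual, h.inner_r_p_self]
    rw [negTest] at hneg
    have h1 := mul_le_mul_of_nonneg_left hneg (sq_nonneg σ)
    have h2 := mul_le_mul_of_nonneg_left hsq hε.le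
    have h3 := mul_nonneg hσ (sq_nonneg ‖(cgIter g (shifted H ε) j).r‖)
    linarith [h.objective_nonpos]
  · have hpos := shifted_inner_pos hε.le hneg
    have hnorm : δ ≤ ‖(cgIter g (shifted H ε) (j + 1)).y‖ := htest.resolve_left hneg
    have hα : 0 < cgAlpha g (shifted H ε) j := div_pos (pow_pos (norm_pos_iff.2 hr) 2) hpos
    have hp : 0 < ‖(cgIter g (shifted H ε) j).p‖ := by
      rw [norm_pos_iff]; rintro h0; simp [h0] at hpos
    -- Beyond `α_j` the norm exceeds `‖y_{j+1}‖`, so the boundary point lies before `α_j`.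
    have hle : σ ≤ cgAlpha g (shifted H ε) j := by
      by_contra! hlt
      rw [cgIter_succ_y] at hnorm
      have h1 := pow_le_pow_left₀ (hs ▸ norm_nonneg _) hnorm 2
      rw [← hs, norm_add_sq_real, norm_add_sq_real, inner_smul_right, inner_smul_right, norm_smul,
        norm_smul, Real.norm_eq_abs, Real.norm_eq_abs, abs_of_nonneg hσ, abs_of_pos hα] at h1
      have h2 := mul_le_mul_of_nonneg_right hlt.le h.inner_y_p_nonneg
      have h3 : cgAlpha g (shifted H ε) j * ‖(cgIter g (shifted H ε) j).p‖
        < σ * ‖(cgIter g (shifted H ε) j).p‖ := mul_lt_mul_of_pos_right hlt hp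
      have h4 := pow_lt_pow_left₀ h3 (by positivity) two_ne_zero
      linarith
    have := h.objective_add_smul_nonpos (shifted_symm hH ε) hpos hσ hle
    nlinarith [mul_nonneg hε.le (sq_nonneg δ)]

lemma interior_modelDecrease (hH : ∀ u v, inner ℝ (H u) v = inner ℝ u (H v)) (hg : g ≠ 0)
    (hε : 0 < ε) (hζ : 0 ≤ ζ) {j : ℕ} (hj : entersPass g H ε δ ζ kmax j)
    (hneg : ¬ negTest g H ε j) :
    ε * ‖(cgIter g (shifted H ε) (j + 1)).y‖ ^ 2
      ≤ modelDecrease g H (cgIter g (shifted H ε) (j + 1)).y := by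
  have h := hj.cgRelations hH hg hε.le hζ
  have hpos := shifted_inner_pos hε.le hneg
  rw [modelDecrease_eq (ε := ε)]
  have := h.objective_add_smul_nonpos (shifted_symm hH ε) hpos
    (t := cgAlpha g (shifted H ε) j) (div_nonneg (sq_nonneg _) hpos.le) le_rfl
  rw [← cgIter_succ_y] at this
  linarith

lemma CGReturns.boundary (hH : ∀ u v, inner ℝ (H u) v = inner ℝ u (H v)) (hg : g ≠ 0)
    (hε : 0 < ε) (hζ : 0 ≤ ζ) {s : Vec n} {out : OutCG} {m : ℕ}
    (h : CGReturns g H ε δ ζ kmax s out m) (hout : out = .bndNeg ∨ out = .bndNorm) :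
    ‖s‖ = δ ∧ 1 / 2 * ε * ‖s‖ ^ 2 ≤ modelDecrease g H s := by
  cases h with
  | bndNeg j σ hj hneg hσ hs =>
    exact ⟨hs, hs ▸ boundary_modelDecrease hH hg hε hζ hj (Or.inl hneg) hσ hs⟩
  | bndNorm j σ hj hneg hnorm hσ hs =>
    exact ⟨hs, hs ▸ boundary_modelDecrease hH hg hε hζ hj (Or.inr hnorm) hσ hs⟩
  | intRes => simp at hout
  | intMax => simp at hout

lemma CGReturns.interior (hH : ∀ u v, inner ℝ (H u) v = inner ℝ u (H v)) (hg : g ≠ 0)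
    (hε : 0 < ε) (hζ : 0 ≤ ζ) {s : Vec n} {m : ℕ}
    (h : CGReturns g H ε δ ζ kmax s .intRes m) :
    s ≠ 0 ∧ ‖s‖ ≤ δ ∧ 1 / 2 * ε * ‖s‖ ^ 2 ≤ modelDecrease g H s ∧
      ‖g + shifted H ε s‖ ≤ ζ / 2 * (ε * ‖s‖) := by
  cases h with
  | intRes j hj hneg hnorm hres =>
    have hdec := interior_modelDecrease hH hg hε hζ hj hneg
    rw [resTest, cgIter_residual] at hres
    refine ⟨fun h0 => hg ?_, (not_le.1 hnorm).le, le_trans ?_ hdec,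
      hres.trans (mul_le_mul_of_nonneg_left (min_le_right _ _) (by linarith))⟩
    · rw [h0] at hres
      simpa using hres
    · nlinarith [mul_nonneg hε.le (sq_nonneg ‖(cgIter g (shifted H ε) (j + 1)).y‖)]

/-- The residual test does not involve the radius, so the flags INT-MAX and INT-RES exclude each
other at a given point, whatever the radii. -/
lemma CGReturns.not_intRes_of_intMax {δ' : ℝ} {s s' : Vec n} {m m' : ℕ}
    (h : CGReturns g H ε δ ζ kmax s .intMax m) :
    ¬ CGReturns g H ε δ' ζ kmax s' .intRes m' := by
  rintro (_ | _ | ⟨j, hj, hneg, hnorm, hres⟩ | _)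
  cases h with
  | intMax _ hm hpass => exact (hpass j (by exact_mod_cast hj.1.trans_le hm)).2.2.2 hres

lemma CGReturns.passes_le {s : Vec n} {out : OutCG} {m : ℕ}
    (h : CGReturns g H ε δ ζ kmax s out m) {K : ℕ} (hK : kmax ≤ K) : m ≤ K := by
  have key : ∀ j, entersPass g H ε δ ζ kmax j → j + 1 ≤ K := fun j hj =>
    Nat.succ_le_of_lt (by exact_mod_cast hj.1.trans_le hK)
  cases h with
  | bndNeg j σ hj => exact key j hj
  | bndNorm j σ hj => exact key j hj
  | intRes j hj => exact key j hj
  | intMax m hm hpass =>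
    cases m with
    | zero => exact Nat.zero_le K
    | succ m => exact key m (hpass m (Nat.lt_succ_self m)).1

end TruncatedCG

/-! ### Second-order Taylor bounds -/

section Taylor

variable {n : ℕ} {f : Vec n → ℝ} {U : Set (Vec n)} {x s : Vec n}

lemma differentiableAt_gradient (h : ContDiffAt ℝ 2 f x) : DifferentiableAt ℝ (gradient f) x := by
  have h1 : DifferentiableAt ℝ (fderiv ℝ f) x :=
    (h.fderiv_right (m := 1) (by norm_num)).differentiableAt (by norm_num)
  rw [differentiableAt_euclidean]
  intro i
  have h2 : (fun y => gradient f y i)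
      = fun y => fderiv ℝ f y (EuclideanSpace.single i (1 : ℝ)) := by
    funext y
    rw [← inner_gradient_left, EuclideanSpace.inner_single_right]
    simp
  rw [h2]
  exact h1.clm_apply (differentiableAt_const _)

lemma inner_hess (h : ContDiffAt ℝ 2 f x) (u v : Vec n) :
    inner ℝ (hess f x u) v = fderiv ℝ (fderiv ℝ f) x u v := by
  have h1 : DifferentiableAt ℝ (fderiv ℝ f) x :=
    (h.fderiv_right (m := 1) (by norm_num)).differentiableAt (by norm_num)
  have h2 : HasFDerivAt (fun y => inner ℝ (gradient f y) v) _ x :=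
    (differentiableAt_gradient h).hasFDerivAt.inner ℝ (hasFDerivAt_const v x)
  have h3 : HasFDerivAt (fun y => fderiv ℝ f y v) _ x :=
    h1.hasFDerivAt.clm_apply (hasFDerivAt_const v x)
  simp only [inner_gradient_left] at h2
  have := congrArg (fun T => T u) (h2.unique h3)
  simpa [hess] using this

lemma hess_symm (h : ContDiffAt ℝ 2 f x) (u v : Vec n) :
    inner ℝ (hess f x u) v = inner ℝ u (hess f x v) := by
  rw [real_inner_comm _ u, inner_hess h, inner_hess h]
  exact (h.isSymmSndFDerivAt (by simp)) u v

lemma segment_point_mem {t : ℝ} (ht : t ∈ Set.Icc (0 : ℝ) 1) (hseg : segment ℝ x (x + s) ⊆ U) :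
    x + t • s ∈ U :=
  hseg (by rw [segment_eq_image']; exact ⟨t, ht, by simp⟩)

lemma norm_gradient_add_smul_sub_le {L : ℝ≥0} (hU : IsOpen U) (hf : ContDiffOn ℝ 2 f U)
    (hL : LipschitzOnWith L (hess f) U) (hseg : segment ℝ x (x + s) ⊆ U) {t : ℝ}
    (ht : t ∈ Set.Icc (0 : ℝ) 1) :
    ‖gradient f (x + t • s) - gradient f x - t • hess f x s‖ ≤ L / 2 * ‖s‖ ^ 2 * t ^ 2 := by
  have hx : x ∈ U := hseg (left_mem_segment ℝ x _)
  have hd : ∀ t ∈ Set.Icc (0 : ℝ) 1, HasDerivAt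
      (fun t : ℝ => gradient f (x + t • s) - gradient f x - t • hess f x s)
      (hess f (x + t • s) s - hess f x s) t := by
    intro t ht
    have h1 : HasFDerivAt (gradient f) (hess f (x + t • s)) (x + t • s) :=
      (differentiableAt_gradient
        (hf.contDiffAt (hU.mem_nhds (segment_point_mem ht hseg)))).hasFDerivAt
    have h2 : HasDerivAt (fun t : ℝ => x + t • s) s t := by
      simpa using ((hasDerivAt_id t).smul_const s).const_add x
    have h3 : HasDerivAt (fun t : ℝ => t • hess f x s) (hess f x s) t := by
      simpa using (hasDerivAt_id t).smul_const (hess f x s)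
    have h4 : HasDerivAt (fun t : ℝ => gradient f (x + t • s)) (hess f (x + t • s) s) t :=
      HasFDerivAt.comp_hasDerivAt (l := gradient f) (l' := hess f (x + t • s))
        (f := fun t : ℝ => x + t • s) t h1 h2
    exact (h4.sub_const _).sub h3
  refine image_norm_le_of_norm_deriv_right_le_deriv_boundary
    (B := fun t => L / 2 * ‖s‖ ^ 2 * t ^ 2) (B' := fun t => L * ‖s‖ ^ 2 * t)
    (fun t ht => (hd t ht).continuousAt.continuousWithinAt)
    (fun t ht => (hd t ⟨ht.1, ht.2.le⟩).hasDerivWithinAt) (by simp) ?_ ?_ ht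
  · intro t
    convert! ((hasDerivAt_id t).pow 2).const_mul (L / 2 * ‖s‖ ^ 2) using 1
    simp; ring
  · intro t ht
    have h1 : ‖hess f (x + t • s) - hess f x‖ ≤ L * ‖x + t • s - x‖ :=
      hL.norm_sub_le (segment_point_mem ⟨ht.1, ht.2.le⟩ hseg) hx
    rw [add_sub_cancel_left, norm_smul, Real.norm_eq_abs, abs_of_nonneg ht.1] at h1
    calc ‖hess f (x + t • s) s - hess f x s‖
        = ‖(hess f (x + t • s) - hess f x) s‖ := by rw [sub_apply]
      _ ≤ ‖hess f (x + t • s) - hess f x‖ * ‖s‖ := ContinuousLinearMap.le_opNorm _ _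
      _ ≤ L * (t * ‖s‖) * ‖s‖ := mul_le_mul_of_nonneg_right h1 (norm_nonneg _)
      _ = _ := by ring

lemma norm_gradient_add_sub_le {L : ℝ≥0} (hU : IsOpen U) (hf : ContDiffOn ℝ 2 f U)
    (hL : LipschitzOnWith L (hess f) U) (hseg : segment ℝ x (x + s) ⊆ U) :
    ‖gradient f (x + s) - gradient f x - hess f x s‖ ≤ L / 2 * ‖s‖ ^ 2 := by
  simpa using norm_gradient_add_smul_sub_le hU hf hL hseg (t := 1) (by simp)

lemma abs_sub_model_le {L : ℝ≥0} (hU : IsOpen U) (hf : ContDiffOn ℝ 2 f U)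
    (hL : LipschitzOnWith L (hess f) U) (hseg : segment ℝ x (x + s) ⊆ U) :
    |f (x + s) - model f x (x + s)| ≤ L / 6 * ‖s‖ ^ 3 := by
  have hd : ∀ t ∈ Set.Icc (0 : ℝ) 1, HasDerivAt
      (fun t : ℝ => f (x + t • s) - f x - t * inner ℝ (gradient f x) s
        - t ^ 2 * (1 / 2 * inner ℝ s (hess f x s)))
      (inner ℝ (gradient f (x + t • s) - gradient f x - t • hess f x s) s) t := by
    intro t ht
    have h1 := ((hf.contDiffAt (hU.mem_nhds (segment_point_mem ht hseg))).differentiableAt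
      (by norm_num)).hasFDerivAt
    have h2 : HasDerivAt (fun t : ℝ => x + t • s) s t := by
      simpa using ((hasDerivAt_id t).smul_const s).const_add x
    have h3 := (hasDerivAt_id t).mul_const (inner ℝ (gradient f x) s)
    have h4 := ((hasDerivAt_id t).pow 2).mul_const (1 / 2 * inner ℝ s (hess f x s))
    convert! (((h1.comp_hasDerivAt t h2).sub_const (f x)).sub h3).sub h4 using 1
    rw [inner_sub_left, inner_sub_left, inner_smul_left, inner_gradient_left,
      real_inner_comm s (hess f x s)]
    simp; ring
  have := image_norm_le_of_norm_deriv_right_le_deriv_boundary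
    (B := fun t => L / 6 * ‖s‖ ^ 3 * t ^ 3) (B' := fun t => L / 2 * ‖s‖ ^ 3 * t ^ 2)
    (fun t ht => (hd t ht).continuousAt.continuousWithinAt)
    (fun t ht => (hd t ⟨ht.1, ht.2.le⟩).hasDerivWithinAt) (by simp) ?_ ?_
    (Set.right_mem_Icc.2 zero_le_one)
  · simp only [one_smul, one_mul, one_pow, mul_one, Real.norm_eq_abs] at this
    refine le_of_eq_of_le (congrArg _ ?_) this
    simp only [model, add_sub_cancel_left]
    ring
  · intro t
    convert! ((hasDerivAt_id t).pow 3).const_mul (L / 6 * ‖s‖ ^ 3) using 1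
    simp; ring
  · intro t ht
    refine (norm_inner_le_norm _ _).trans ?_
    have := norm_gradient_add_smul_sub_le hU hf hL hseg ⟨ht.1, ht.2.le⟩
    calc _ ≤ L / 2 * ‖s‖ ^ 2 * t ^ 2 * ‖s‖ := mul_le_mul_of_nonneg_right this (norm_nonneg _)
      _ = _ := by ring

end Taylor

/-! ### A single iteration -/

section Iteration

variable {n : ℕ} {f : Vec n → ℝ} {P : Params} {εg εH : ℝ} {S : State n}

lemma model_sub_model (f : Vec n → ℝ) (x s : Vec n) :
    model f x x - model f x (x + s) = modelDecrease (gradient f x) (hess f x) s := by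
  simp [model, modelDecrease]
  ring

/-- At `x`, truncated CG never returns an interior step that the method would take, whatever the
trust-region radius. -/
def NoInteriorStep (f : Vec n → ℝ) (P : Params) (εg εH : ℝ) (x : Vec n) : Prop :=
  εg < ‖gradient f x‖ → ∀ (δ : ℝ) (s : Vec n) (m : ℕ),
    ¬ CGReturns (gradient f x) (hess f x) εH δ P.ζ (kMax P.capCG n P.M εH P.ζ) s .intRes m

/-- What holds of a direction available at `x` once the oracle was asked there: it is a
direction of negative curvature, and interior CG steps are excluded at `x`. -/
def ValidDirection (f : Vec n → ℝ) (P : Params) (εg εH : ℝ) (x : Vec n) (w : Option (Vec n)) :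
    Prop :=
  ∀ v, w = some v → IsNegCurvDir (hess f x) εH v ∧ NoInteriorStep f P εg εH x

lemma CGPhase.noInteriorStep {s : Vec n} {out : OutCG} {a : ℕ} (hεg : 0 ≤ εg)
    (h : CGPhase f P εH S s out a) (hout : ¬ usesCG f εg S.x out) :
    NoInteriorStep f P εg εH S.x := by
  intro hg δ s' m'
  cases h with
  | skip h0 => simp [h0] at hg; linarith
  | call s out m hne h =>
    cases out with
    | bndNeg => simp [usesCG] at hout
    | bndNorm => simp [usesCG] at hout
    | intRes => simp [usesCG, hg] at hout
    | intMax => exact h.not_intRes_of_intMax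

lemma CGPhase.products_le {s : Vec n} {out : OutCG} {a K : ℕ} (h : CGPhase f P εH S s out a)
    (hK : kMax P.capCG n P.M εH P.ζ ≤ K) : a ≤ K := by
  cases h with
  | skip => exact Nat.zero_le K
  | call s out m hg h => exact h.passes_le hK

/-- The consequences of `TrialStep` on which the complexity analysis rests. Either the step
reaches the boundary of the trust region, or it is an interior CG step; the latter never happens
while a direction of negative curvature is available. -/
structure StepProperties (f : Vec n → ℝ) (P : Params) (εg εH : ℝ) (S : State n) (s : Vec n)
    (w : Option (Vec n)) (b : ℕ) : Prop where
  ne_zero : s ≠ 0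
  norm_le : ‖s‖ ≤ S.δ
  decrease : 1 / 4 * εH * ‖s‖ ^ 2 ≤ modelDecrease (gradient f S.x) (hess f S.x) s
  boundary_or_interior : ‖s‖ = S.δ ∨
    (εg < ‖gradient f S.x‖ ∧ S.stored = none ∧ b = 0 ∧
      ‖gradient f S.x + shifted (hess f S.x) εH s‖ ≤ P.ζ / 2 * (εH * ‖s‖))
  valid : ValidDirection f P εg εH S.x w
  oracle : (b = 0 ∧ w = S.stored) ∨ (S.stored = none ∧ w ≠ none)

lemma scaledStep_properties {g v s : Vec n} {H : Vec n →L[ℝ] Vec n} {ε δ : ℝ} (hδ : 0 < δ)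
    (hv : IsNegCurvDir H ε v) (hs : IsScaledStep g δ v s) :
    ‖s‖ = δ ∧ 1 / 4 * ε * ‖s‖ ^ 2 ≤ modelDecrease g H s := by
  obtain ⟨hv1, hvH⟩ := hv
  obtain ⟨hs, hgs⟩ := hs
  have hnorm : ‖s‖ = δ := by
    rcases hs with rfl | rfl <;> simp [norm_smul, hv1, abs_of_pos hδ]
  have hcurv : inner ℝ s (H s) = δ ^ 2 * inner ℝ v (H v) := by
    rcases hs with rfl | rfl <;> simp [inner_smul_left, inner_smul_right] <;> ring
  refine ⟨hnorm, ?_⟩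
  rw [hnorm, modelDecrease, hcurv]
  nlinarith [mul_le_mul_of_nonneg_left hvH (sq_nonneg δ)]

lemma TrialStep.properties (hH : ∀ u v, inner ℝ (hess f S.x u) v = inner ℝ u (hess f S.x v))
    (hεg : 0 ≤ εg) (hεH : 0 < εH) (hδ : 0 < S.δ)
    (hS : ValidDirection f P εg εH S.x S.stored) {s : Vec n} {w : Option (Vec n)} {a b : ℕ}
    (h : TrialStep f P εg εH S s w a b) : StepProperties f P εg εH S s w b := by
  have hne : ∀ {s : Vec n}, ‖s‖ = S.δ → s ≠ 0 := by
    rintro s hs rfl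
    rw [norm_zero] at hs
    exact hδ.ne hs
  cases h with
  | cg s out a hcg hout =>
    cases hcg with
    | skip h0 => simp [usesCG, h0, hεg.not_gt] at hout
    | call s out m hg h =>
      have hbd : out = .bndNeg ∨ out = .bndNorm → StepProperties f P εg εH S s S.stored 0 := by
        intro h1
        obtain ⟨h2, h3⟩ := h.boundary hH hg hεH P.ζ_pos.le h1
        exact ⟨hne h2, h2.le, le_trans (by nlinarith [mul_nonneg hεH.le (sq_nonneg ‖s‖)]) h3,
          Or.inl h2, hS, Or.inl ⟨rfl, rfl⟩⟩
      rcases hout with h1 | h1 | ⟨h1, rfl⟩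
      · exact hbd (Or.inl h1)
      · exact hbd (Or.inr h1)
      · obtain ⟨h2, h3, h4, h5⟩ := h.interior hH hg hεH P.ζ_pos.le
        have hstored : S.stored = none := by
          by_contra h0
          obtain ⟨v, hv⟩ := Option.ne_none_iff_exists'.1 h0
          exact (hS v hv).2 h1 _ _ _ h
        exact ⟨h2, h3, le_trans (by nlinarith [mul_nonneg hεH.le (sq_nonneg ‖s‖)]) h4,
          Or.inr ⟨h1, hstored, rfl, h5⟩, hS, Or.inl ⟨rfl, rfl⟩⟩
  | oracle sCG out v s a b hcg hout hnone hv hs =>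
    obtain ⟨h1, h2⟩ := scaledStep_properties hδ hv hs
    exact ⟨hne h1, h1.le, h2, Or.inl h1,
      fun v' hv' => ⟨Option.some.inj hv' ▸ hv, hcg.noInteriorStep hεg hout⟩,
      Or.inr ⟨hnone, by simp⟩⟩
  | stored sCG out v s a hcg hout hsome hs =>
    obtain ⟨h1, h2⟩ := scaledStep_properties hδ (hS v hsome).1 hs
    exact ⟨hne h1, h1.le, h2, Or.inl h1, hsome ▸ hS, Or.inl ⟨rfl, hsome.symm⟩⟩

/-- A positive lower bound for all trust-region radii of a run. -/
noncomputable def minRadius (P : Params) (LH : ℝ≥0) (εH : ℝ) : ℝ :=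
  min P.δ₀ (3 * P.γ₁ * (1 - P.η) * εH / (2 * LH))

/-- The maximum that occurs in the constant `CbarS`. -/
noncomputable def decreaseFactor (P : Params) (LH : ℝ≥0) : ℝ :=
  max (max (1 / P.δ₀ ^ 2) (4 * (LH : ℝ) ^ 2 / (9 * P.γ₁ ^ 2 * (1 - P.η) ^ 2))) (7 + 2 * (LH : ℝ))

/-- The decrease of `f` in a successful iteration, unless that iteration takes an interior step
from a point with a large gradient to a point with a small one. -/
noncomputable def minDecrease (P : Params) (LH : ℝ≥0) (εH : ℝ) : ℝ :=
  P.η * εH ^ 3 / (4 * decreaseFactor P LH)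

lemma decreaseFactor_pos (P : Params) (LH : ℝ≥0) : 0 < decreaseFactor P LH :=
  lt_of_lt_of_le (by positivity) (le_max_right _ _)

lemma minDecrease_pos (P : Params) (LH : ℝ≥0) (hεH : 0 < εH) : 0 < minDecrease P LH εH :=
  div_pos (mul_pos P.η_pos (pow_pos hεH 3)) (mul_pos (by norm_num) (decreaseFactor_pos P LH))

lemma minRadius_pos (P : Params) {LH : ℝ≥0} (hLH : 0 < LH) (hεH : 0 < εH) :
    0 < minRadius P LH εH := by
  have := P.γ₁_pos
  have := sub_pos.2 P.η_lt
  have : (0 : ℝ) < LH := hLH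
  exact lt_min P.δ₀_pos (by positivity)

lemma sq_le_decreaseFactor_mul_sq {LH : ℝ≥0} (hLH : 0 < LH) (hεH : 0 < εH) (hεH1 : εH ≤ 1)
    {t : ℝ} (ht : minRadius P LH εH ≤ t) : εH ^ 2 ≤ decreaseFactor P LH * t ^ 2 := by
  have hγ := P.γ₁_pos
  have hη := sub_pos.2 P.η_lt
  have hδ := P.δ₀_pos
  have hL : (0 : ℝ) < LH := hLH
  have hQ1 : 1 / P.δ₀ ^ 2 ≤ decreaseFactor P LH := (le_max_left _ _).trans (le_max_left _ _)
  have hQ2 : 4 * (LH : ℝ) ^ 2 / (9 * P.γ₁ ^ 2 * (1 - P.η) ^ 2) ≤ decreaseFactor P LH :=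
    (le_max_right _ _).trans (le_max_left _ _)
  refine le_trans ?_ (mul_le_mul_of_nonneg_left
    (pow_le_pow_left₀ (minRadius_pos P hLH hεH).le ht 2) (decreaseFactor_pos P LH).le)
  rcases min_cases P.δ₀ (3 * P.γ₁ * (1 - P.η) * εH / (2 * LH)) with h | h
  · rw [minRadius, h.1]
    refine le_trans ?_ (mul_le_mul_of_nonneg_right hQ1 (by positivity))
    rw [one_div, inv_mul_cancel₀ (by positivity)]
    exact pow_le_one₀ hεH.le hεH1
  · rw [minRadius, h.1]
    refine le_trans (le_of_eq ?_) (mul_le_mul_of_nonneg_right hQ2 (by positivity))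
    field_simp
    norm_num

/-- The hypotheses on the objective around one iteration. -/
structure LocalSmoothness (f : Vec n → ℝ) (LH : ℝ≥0) (x s : Vec n) : Prop where
  symm : ∀ u v, inner ℝ (hess f x u) v = inner ℝ u (hess f x v)
  gradient_bound : ‖gradient f (x + s) - gradient f x - hess f x s‖ ≤ LH / 2 * ‖s‖ ^ 2
  model_bound : |f (x + s) - model f x (x + s)| ≤ LH / 6 * ‖s‖ ^ 3

variable {LH : ℝ≥0} {s : Vec n} {w : Option (Vec n)} {b : ℕ}

lemma StepProperties.modelDecrease_pos (h : StepProperties f P εg εH S s w b) (hεH : 0 < εH) :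
    0 < modelDecrease (gradient f S.x) (hess f S.x) s :=
  lt_of_lt_of_le (mul_pos (by linarith) (pow_pos (norm_pos_iff.2 h.ne_zero) 2)) h.decrease

lemma StepProperties.minRadius_le_of_failure (h : StepProperties f P εg εH S s w b)
    (hloc : LocalSmoothness f LH S.x s) (hLH : 0 < LH) (hεH : 0 < εH)
    (hfail : ¬ P.η ≤ ratio f S.x s) : minRadius P LH εH ≤ P.γ₁ * ‖s‖ := by
  have hs := norm_pos_iff.2 h.ne_zero
  have hL : (0 : ℝ) < LH := hLH
  have hm := h.modelDecrease_pos hεH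
  have h1 := hloc.model_bound
  have hdec := h.decrease
  have hms := model_sub_model f S.x s
  have hx : model f S.x S.x = f S.x := by simp [model]
  rw [ratio, hms, not_le, div_lt_iff₀ hm] at hfail
  have h2 : (1 - P.η) * (1 / 4 * εH * ‖s‖ ^ 2) ≤ LH / 6 * ‖s‖ ^ 3 := by
    have h3 := mul_le_mul_of_nonneg_left hdec (sub_pos.2 P.η_lt).le
    have h4 := le_of_abs_le h1
    nlinarith
  have h3 : 3 * (1 - P.η) * εH ≤ 2 * LH * ‖s‖ := by
    have h4 : (3 * (1 - P.η) * εH) * ‖s‖ ^ 2 ≤ (2 * LH * ‖s‖) * ‖s‖ ^ 2 := by nlinarith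
    exact le_of_mul_le_mul_right h4 (pow_pos hs 2)
  refine (min_le_right _ _).trans ?_
  rw [div_le_iff₀ (by positivity)]
  nlinarith [mul_le_mul_of_nonneg_left h3 P.γ₁_pos.le]

lemma StepProperties.decrease_of_success (h : StepProperties f P εg εH S s w b) (hεH : 0 < εH)
    (hsucc : P.η ≤ ratio f S.x s) : P.η * (1 / 4 * εH * ‖s‖ ^ 2) ≤ f S.x - f (S.x + s) := by
  rw [ratio, model_sub_model, le_div_iff₀ (h.modelDecrease_pos hεH)] at hsucc
  exact (mul_le_mul_of_nonneg_left h.decrease P.η_pos.le).trans hsucc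

lemma minDecrease_le (hεH : 0 < εH) {t : ℝ} (ht : εH ^ 2 ≤ decreaseFactor P LH * t ^ 2) :
    minDecrease P LH εH ≤ P.η * (1 / 4 * εH * t ^ 2) := by
  have hQ := decreaseFactor_pos P LH
  rw [minDecrease, div_le_iff₀ (by positivity)]
  nlinarith [mul_le_mul_of_nonneg_left ht (mul_pos P.η_pos hεH).le]

/-- A successful iteration decreases `f` by `minDecrease`, unless an interior step leads from a
large gradient to a small one. For an interior step to a large gradient, the Taylor bound
`ε_g < ‖∇f(x + s)‖ ≤ L_H/2 ‖s‖² + 5/2 ε_H ‖s‖` keeps `‖s‖` away from zero. -/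
lemma StepProperties.minDecrease_le_or (h : StepProperties f P εg εH S s w b)
    (hloc : LocalSmoothness f LH S.x s) (hLH : 0 < LH) (hεH : 0 < εH) (hεH1 : εH ≤ 1)
    (hεg : εg = εH ^ 2) (hδ : minRadius P LH εH ≤ S.δ) (hsucc : P.η ≤ ratio f S.x s) :
    minDecrease P LH εH ≤ f S.x - f (S.x + s) ∨
      (‖gradient f (S.x + s)‖ ≤ εg ∧ εg < ‖gradient f S.x‖ ∧ S.stored = none ∧ b = 0) := by
  have hdec := h.decrease_of_success hεH hsucc
  rcases h.boundary_or_interior with hs | ⟨h1, h2, h3, hres⟩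
  · exact Or.inl ((minDecrease_le hεH
      (sq_le_decreaseFactor_mul_sq hLH hεH hεH1 (hs ▸ hδ))).trans hdec)
  · by_cases hg : ‖gradient f (S.x + s)‖ ≤ εg
    · exact Or.inr ⟨hg, h1, h2, h3⟩
    · refine Or.inl ((minDecrease_le hεH ?_).trans hdec)
      have hQ : 7 + 2 * (LH : ℝ) ≤ decreaseFactor P LH := le_max_right _ _
      have hsplit : gradient f (S.x + s) = (gradient f (S.x + s) - gradient f S.x - hess f S.x s)
          + (gradient f S.x + shifted (hess f S.x) εH s) - (2 * εH) • s := by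
        simp [shifted]
        abel
      have hnorm : ‖gradient f (S.x + s)‖ ≤ LH / 2 * ‖s‖ ^ 2 + P.ζ / 2 * (εH * ‖s‖)
          + 2 * εH * ‖s‖ := by
        rw [hsplit]
        refine (norm_sub_le _ _).trans (add_le_add ((norm_add_le _ _).trans
          (add_le_add hloc.gradient_bound hres)) (le_of_eq ?_))
        rw [norm_smul, Real.norm_eq_abs, abs_of_pos (by linarith)]
      have hζ := mul_le_mul_of_nonneg_right P.ζ_lt.le (mul_nonneg hεH.le (norm_nonneg s))
      have hlow : εH ^ 2 ≤ (7 + 2 * (LH : ℝ)) * ‖s‖ ^ 2 := by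
        have := LH.coe_nonneg
        nlinarith [sq_nonneg (2 * εH - 5 * ‖s‖), sq_nonneg ‖s‖,
          mul_nonneg this (sq_nonneg ‖s‖)]
      exact hlow.trans (mul_le_mul_of_nonneg_right hQ (sq_nonneg _))

end Iteration

/-! ### Counting iterations and oracle calls -/

section Counting

variable {n : ℕ} {f : Vec n → ℝ} {P : Params} {εg εH : ℝ} {x₀ : Vec n}

open Classical in
/-- `1` at points with a small gradient, `0` elsewhere. -/
noncomputable def smallGradient (f : Vec n → ℝ) (εg : ℝ) (x : Vec n) : ℝ :=
  if ‖gradient f x‖ ≤ εg then 1 else 0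

open Classical in
/-- `1` if a direction is stored, `0` otherwise. -/
noncomputable def hasStored (w : Option (Vec n)) : ℝ := if w = none then 0 else 1

lemma smallGradient_le_one (f : Vec n → ℝ) (εg : ℝ) (x : Vec n) : smallGradient f εg x ≤ 1 := by
  rw [smallGradient]; split_ifs <;> norm_num

lemma smallGradient_nonneg (f : Vec n → ℝ) (εg : ℝ) (x : Vec n) : 0 ≤ smallGradient f εg x := by
  rw [smallGradient]; split_ifs <;> norm_num

lemma hasStored_le_one (w : Option (Vec n)) : hasStored w ≤ 1 := by
  rw [hasStored]; split_ifs <;> norm_num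

/-- The state of a run after `a` successful and `b` unsuccessful iterations and `o` oracle calls.

A success either decreases `f` by `minDecrease` or turns a large gradient into a small one, and
never two in a row do only the latter: hence `f` together with the indicator of a small gradient
bounds `a`. An oracle call stores its direction until the next success, which decreases `f` by
`minDecrease`: hence `f` together with the indicator of a stored direction bounds `o`. -/
structure Progress (f : Vec n → ℝ) (P : Params) (εg εH : ℝ) (x₀ : Vec n) (LH : ℝ≥0)
    (S : State n) (a b o : ℕ) : Prop where
  successes : a * minDecrease P LH εH
    ≤ 2 * (f x₀ - f S.x) + smallGradient f εg S.x * minDecrease P LH εH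
  oracleCalls : o * minDecrease P LH εH ≤ f x₀ - f S.x + hasStored S.stored * minDecrease P LH εH
  radius_ge : minRadius P LH εH ≤ S.δ
  radius_le : S.δ ≤ P.γ₁ ^ b * P.γ₂ ^ a * P.δ₀
  valid : ValidDirection f P εg εH S.x S.stored

variable {LH : ℝ≥0} {S : State n} {s : Vec n} {w : Option (Vec n)} {a b o q : ℕ}

lemma progress_init (hεH : 0 < εH) :
    Progress f P εg εH x₀ LH ⟨x₀, P.δ₀, none⟩ 0 0 0 where
  successes := by
    simpa using mul_nonneg (smallGradient_nonneg f εg x₀) (minDecrease_pos P LH hεH).le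
  oracleCalls := by simp [hasStored]
  radius_ge := min_le_left _ _
  radius_le := by simp
  valid := by simp [ValidDirection]

lemma Progress.update_success (h : Progress f P εg εH x₀ LH S a b o)
    (hstep : StepProperties f P εg εH S s w q) (hloc : LocalSmoothness f LH S.x s) (hLH : 0 < LH)
    (hεH : 0 < εH) (hεH1 : εH ≤ 1) (hεg : εg = εH ^ 2) (hsucc : P.η ≤ ratio f S.x s) :
    ∃ o', Progress f P εg εH x₀ LH (S.update f P s w) (a + 1) b o' ∧
      (o' = o + 1 ∨ (o' = o ∧ q = 0)) := by
  have hD := minDecrease_pos P LH hεH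
  have hupd : S.update f P s w
      = ⟨S.x + s, if P.ψ * S.δ ≤ ‖s‖ then min (P.γ₂ * S.δ) P.δmax else S.δ, none⟩ := if_pos hsucc
  have hδ : 0 < S.δ := (minRadius_pos P hLH hεH).trans_le h.radius_ge
  have hγ : S.δ ≤ P.γ₂ * S.δ := le_mul_of_one_le_left hδ.le P.one_le_γ₂
  have hge : minRadius P LH εH
      ≤ if P.ψ * S.δ ≤ ‖s‖ then min (P.γ₂ * S.δ) P.δmax else S.δ := by
    split_ifs
    · exact le_min (h.radius_ge.trans hγ) ((min_le_left _ _).trans P.δ₀_le)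
    · exact h.radius_ge
  have hle : (if P.ψ * S.δ ≤ ‖s‖ then min (P.γ₂ * S.δ) P.δmax else S.δ)
      ≤ P.γ₁ ^ b * P.γ₂ ^ (a + 1) * P.δ₀ := by
    have h1 : P.γ₂ * S.δ ≤ P.γ₁ ^ b * P.γ₂ ^ (a + 1) * P.δ₀ := by
      have := mul_le_mul_of_nonneg_left h.radius_le (zero_le_one.trans P.one_le_γ₂)
      rw [pow_succ]
      linarith
    split_ifs
    · exact (min_le_left _ _).trans h1
    · exact hγ.trans h1
  have hvalid : ValidDirection f P εg εH (S.x + s) none := by simp [ValidDirection]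
  have hs1 := h.successes
  have ho1 := h.oracleCalls
  have hι := mul_le_mul_of_nonneg_right (smallGradient_le_one f εg S.x) hD.le
  have hι' := mul_nonneg (smallGradient_nonneg f εg (S.x + s)) hD.le
  have hτ0 : hasStored (none : Option (Vec n)) = 0 := if_pos rfl
  rw [hupd]
  rcases hstep.minDecrease_le_or hloc hLH hεH hεH1 hεg h.radius_ge hsucc with
    hdec | ⟨hsmall, hlarge, hnone, hq⟩
  · rcases hstep.oracle with ⟨hq, -⟩ | ⟨hnone, -⟩
    · refine ⟨o, ⟨?_, ?_, hge, hle, hvalid⟩, Or.inr ⟨rfl, hq⟩⟩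
      · push_cast; linarith
      · have hτ := mul_le_mul_of_nonneg_right (hasStored_le_one S.stored) hD.le
        rw [hτ0]
        linarith
    · refine ⟨o + 1, ⟨?_, ?_, hge, hle, hvalid⟩, Or.inl rfl⟩
      · push_cast; linarith
      · rw [hnone, hτ0] at ho1
        rw [hτ0]
        push_cast
        linarith
  · have hf : f (S.x + s) ≤ f S.x := by
      have := hstep.decrease_of_success hεH hsucc
      have h0 : 0 ≤ P.η * (1 / 4 * εH * ‖s‖ ^ 2) := by
        have := P.η_pos
        positivity
      linarith
    refine ⟨o, ⟨?_, ?_, hge, hle, hvalid⟩, Or.inr ⟨rfl, hq⟩⟩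
    · have h1 : smallGradient f εg (S.x + s) = 1 := if_pos hsmall
      have h0 : smallGradient f εg S.x = 0 := if_neg hlarge.not_ge
      rw [h0] at hs1
      rw [h1]
      push_cast
      linarith
    · rw [hnone, hτ0] at ho1
      rw [hτ0]
      linarith

lemma Progress.update_failure (h : Progress f P εg εH x₀ LH S a b o)
    (hstep : StepProperties f P εg εH S s w q) (hloc : LocalSmoothness f LH S.x s) (hLH : 0 < LH)
    (hεH : 0 < εH) (hfail : ¬ P.η ≤ ratio f S.x s) :
    ∃ o', Progress f P εg εH x₀ LH (S.update f P s w) a (b + 1) o' ∧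
      (o' = o + 1 ∨ (o' = o ∧ q = 0)) := by
  have hupd : S.update f P s w = ⟨S.x, P.γ₁ * ‖s‖, w⟩ := if_neg hfail
  have hge := hstep.minRadius_le_of_failure hloc hLH hεH hfail
  have hle : P.γ₁ * ‖s‖ ≤ P.γ₁ ^ (b + 1) * P.γ₂ ^ a * P.δ₀ := by
    have := mul_le_mul_of_nonneg_left (hstep.norm_le.trans h.radius_le) P.γ₁_pos.le
    rw [pow_succ]
    linarith
  rw [hupd]
  rcases hstep.oracle with ⟨hq, rfl⟩ | ⟨hnone, hw⟩
  · exact ⟨o, ⟨h.successes, h.oracleCalls, hge, hle, hstep.valid⟩, Or.inr ⟨rfl, hq⟩⟩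
  · refine ⟨o + 1, ⟨h.successes, ?_, hge, hle, hstep.valid⟩, Or.inl rfl⟩
    have h1 := h.oracleCalls
    rw [hnone, show hasStored (none : Option (Vec n)) = 0 from if_pos rfl] at h1
    rw [show hasStored w = 1 from if_neg hw]
    push_cast
    linarith

lemma Run.localSmoothness {R : Run f P εg εH x₀} {flow : ℝ} {Lg : ℝ≥0}
    (hR : R.ObjectiveAssumption flow Lg LH) {k : ℕ} (hk : (k : ℕ∞) < R.len) :
    LocalSmoothness f LH (R.state k).x (R.s k) := by
  obtain ⟨U, hU, hmem, hseg, hf, -, hH⟩ := hR.smooth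
  exact ⟨hess_symm (hf.contDiffAt (hU.mem_nhds (hmem k hk.le))),
    norm_gradient_add_sub_le hU hf hH (hseg k hk), abs_sub_model_le hU hf hH (hseg k hk)⟩

/-- The counts at iteration `k` of a run, and the number of oracle products they allow. -/
lemma Run.exists_progress {R : Run f P εg εH x₀} {flow Cmeo : ℝ} {Lg : ℝ≥0}
    (hR : R.ObjectiveAssumption flow Lg LH) (hO : R.OracleAssumption Cmeo) (hLH : 0 < LH)
    (hεH : 0 < εH) (hεH1 : εH ≤ 1) (hεg : εg = εH ^ 2) {k : ℕ} (hk : (k : ℕ∞) ≤ R.len) :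
    ∃ a b o : ℕ, a + b = k ∧ Progress f P εg εH x₀ LH (R.state k) a b o ∧
      ∑ i ∈ Finset.range k, R.oracleProducts i ≤ Nmeo n Cmeo εH * o := by
  induction k with
  | zero => exact ⟨0, 0, 0, rfl, R.init ▸ progress_init hεH, by simp⟩
  | succ k ih =>
    have hk' : (k : ℕ∞) < R.len :=
      lt_of_lt_of_le (by exact_mod_cast Nat.lt_succ_self k) hk
    obtain ⟨a, b, o, hab, h, hsum⟩ := ih hk'.le
    obtain ⟨w, htrial, hnext⟩ := R.step k hk'
    have hloc := Run.localSmoothness hR hk'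
    have hstep := htrial.properties hloc.symm (hεg ▸ sq_nonneg εH) hεH
      ((minRadius_pos P hLH hεH).trans_le h.radius_ge) h.valid
    have hfin : ∀ {o' : ℕ}, (o' = o + 1 ∨ (o' = o ∧ R.oracleProducts k = 0)) →
        ∑ i ∈ Finset.range (k + 1), R.oracleProducts i ≤ Nmeo n Cmeo εH * o' := by
      rintro o' ho
      rw [Finset.sum_range_succ]
      rcases ho with rfl | ⟨rfl, h0⟩
      · rw [mul_add, mul_one]
        exact add_le_add hsum (hO k hk'.le)
      · rwa [h0, add_zero]
    rw [hnext]
    by_cases hsucc : P.η ≤ ratio f (R.state k).x (R.s k)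
    · obtain ⟨o', hp, ho⟩ := h.update_success hstep hloc hLH hεH hεH1 hεg hsucc
      exact ⟨a + 1, b, o', by omega, hp, hfin ho⟩
    · obtain ⟨o', hp, ho⟩ := h.update_failure hstep hloc hLH hεH hsucc
      exact ⟨a, b + 1, o', by omega, hp, hfin ho⟩

/-- The iterations each use at most `K` products in CG, and the oracle is called at most
`KbarS` times, the terminating call included. -/
lemma Run.products_le {R : Run f P εg εH x₀} {flow Cmeo : ℝ} {Lg : ℝ≥0}
    (hR : R.ObjectiveAssumption flow Lg LH) (hO : R.OracleAssumption Cmeo) (hLH : 0 < LH)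
    (hεH : 0 < εH) (hεH1 : εH ≤ 1) (hεg : εg = εH ^ 2) {N K : ℕ} (hN : R.len = N)
    (hK : kMax P.capCG n P.M εH P.ζ ≤ K) :
    R.products N ≤ K * (N + 1) + Nmeo n Cmeo εH * KbarS P LH (f x₀ - flow) εg εH := by
  obtain ⟨a, b, o, -, h, hsum⟩ := R.exists_progress hR hO hLH hεH hεH1 hεg hN.ge
  have hcg : ∀ k ∈ Finset.range (N + 1), R.cgProducts k ≤ K := by
    intro k hk
    rcases (Nat.lt_succ_iff.1 (Finset.mem_range.1 hk)).lt_or_eq with hlt | rfl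
    · obtain ⟨w, htrial, -⟩ := R.step k (by rw [hN]; exact_mod_cast hlt)
      generalize R.cgProducts k = c at htrial
      generalize R.oracleProducts k = d at htrial
      cases htrial with
      | cg s out a hcg hout => exact hcg.products_le hK
      | oracle sCG out v s a b hcg => exact hcg.products_le hK
      | stored sCG out v s a hcg => exact hcg.products_le hK
    · obtain ⟨sCG, out, _, _, hcg, -⟩ := R.last k hN.symm
      exact hcg.products_le hK
  have hnone : (R.state N).stored = none := by
    obtain ⟨_, _, _, _, -, -, hnone⟩ := R.last N hN.symm
    exact hnone
  have ho : o + 1 ≤ KbarS P LH (f x₀ - flow) εg εH := by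
    rw [KbarS]
    refine Nat.succ_le_succ (Nat.le_floor ?_)
    have h1 := h.oracleCalls
    have hflow := hR.lower N hN.ge
    have hΔ : 0 ≤ f x₀ - flow := by
      have := hR.lower 0 (by simp)
      rw [R.init] at this
      exact sub_nonneg.2 this
    rw [hnone, show hasStored (none : Option (Vec n)) = 0 from if_pos rfl, zero_mul, add_zero] at h1
    have hQ := decreaseFactor_pos P LH
    have hη := P.η_pos
    have h2 : (o : ℝ) ≤ (f x₀ - flow) / minDecrease P LH εH := by
      rw [le_div_iff₀ (minDecrease_pos P LH hεH)]
      linarith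
    have hC : CbarS P LH (f x₀ - flow) = 8 * (f x₀ - flow) / P.η * decreaseFactor P LH := rfl
    have hC0 : 0 ≤ CbarS P LH (f x₀ - flow) := by rw [hC]; positivity
    calc (o : ℝ) ≤ (f x₀ - flow) / minDecrease P LH εH := h2
      _ = 4 * (f x₀ - flow) / P.η * decreaseFactor P LH * (εH ^ 3)⁻¹ := by
        rw [minDecrease]; field_simp
      _ ≤ CbarS P LH (f x₀ - flow) * (εH ^ 3)⁻¹ := by
        rw [hC]; gcongr; norm_num
      _ ≤ _ := mul_le_mul_of_nonneg_left (le_max_right _ _) hC0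
  rw [Run.products, Finset.sum_add_distrib]
  refine add_le_add ?_ ?_
  · calc ∑ k ∈ Finset.range (N + 1), R.cgProducts k
        ≤ (Finset.range (N + 1)).card • K := Finset.sum_le_card_nsmul _ _ _ hcg
      _ = K * (N + 1) := by rw [Finset.card_range, smul_eq_mul, mul_comm]
  · rw [Finset.sum_range_succ]
    calc _ ≤ Nmeo n Cmeo εH * o + Nmeo n Cmeo εH := add_le_add hsum (hO N hN.ge)
      _ = Nmeo n Cmeo εH * (o + 1) := by ring
      _ ≤ _ := Nat.mul_le_mul_left _ ho

/-- The constant in the bound on the number of successful iterations of a run. -/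
noncomputable def successConst (P : Params) (LH : ℝ≥0) (Δ : ℝ) : ℝ :=
  8 * |Δ| / P.η * decreaseFactor P LH + 1

/-- The constant in the bound on the number of all iterations of a run. -/
noncomputable def iterationConst (P : Params) (LH : ℝ≥0) (Δ : ℝ) : ℝ :=
  successConst P LH Δ + 1 + (successConst P LH Δ * Real.log P.γ₂
    + Real.log (P.δ₀ / minRadius P LH 1) + 1) / -Real.log P.γ₁

lemma one_le_successConst (P : Params) (LH : ℝ≥0) (Δ : ℝ) : 1 ≤ successConst P LH Δ := by
  have hQ := decreaseFactor_pos P LH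
  have hη := P.η_pos
  rw [successConst]
  exact le_add_of_nonneg_left (by positivity)

lemma minRadius_one_mul_le (P : Params) (hεH : 0 < εH) (hεH1 : εH ≤ 1) :
    minRadius P LH 1 * εH ≤ minRadius P LH εH := by
  refine le_min ?_ ?_
  · calc minRadius P LH 1 * εH ≤ P.δ₀ * εH :=
          mul_le_mul_of_nonneg_right (min_le_left _ _) hεH.le
      _ ≤ P.δ₀ := mul_le_of_le_one_right P.δ₀_pos.le hεH1
  · calc minRadius P LH 1 * εH ≤ 3 * P.γ₁ * (1 - P.η) * 1 / (2 * LH) * εH :=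
          mul_le_mul_of_nonneg_right (min_le_right _ _) hεH.le
      _ = _ := by ring

lemma one_le_iterationConst (P : Params) (hLH : 0 < LH) (Δ : ℝ) :
    1 ≤ iterationConst P LH Δ := by
  have h1 := one_le_successConst P LH Δ
  have h2 : 0 ≤ Real.log P.γ₂ := Real.log_nonneg P.one_le_γ₂
  have h3 : 0 ≤ -Real.log P.γ₁ := neg_nonneg.2 (Real.log_nonpos P.γ₁_pos.le P.γ₁_lt.le)
  have h4 : 0 ≤ Real.log (P.δ₀ / minRadius P LH 1) :=
    Real.log_nonneg ((one_le_div (minRadius_pos P hLH one_pos)).2 (min_le_left _ _))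
  rw [iterationConst]
  have : 0 ≤ (successConst P LH Δ * Real.log P.γ₂
    + Real.log (P.δ₀ / minRadius P LH 1) + 1) / -Real.log P.γ₁ := by positivity
  linarith

/-- The radius shrinks by `γ₁` at every failure, grows at most by `γ₂` at every success, and stays
above `minRadius`; so the failures are controlled by the successes. -/
lemma Progress.add_one_le (h : Progress f P εg εH x₀ LH S a b o) {flow Δ : ℝ} (hLH : 0 < LH)
    (hεH : 0 < εH) (hεH1 : εH ≤ 1) (hflow : flow ≤ f S.x) (hΔ : f x₀ - flow ≤ Δ) :
    (a + b : ℝ) + 1 ≤ iterationConst P LH Δ * (εH ^ 3)⁻¹ := by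
  have hD := minDecrease_pos P LH hεH
  have hQ := decreaseFactor_pos P LH
  have hη := P.η_pos
  have hε3 : 0 < εH ^ 3 := pow_pos hεH 3
  have hE1 : 1 ≤ (εH ^ 3)⁻¹ := (one_le_inv₀ hε3).2 (pow_le_one₀ hεH.le hεH1)
  have ha : (a : ℝ) ≤ successConst P LH Δ * (εH ^ 3)⁻¹ := by
    have h1 : (a : ℝ) ≤ 2 * |Δ| / minDecrease P LH εH + 1 := by
      rw [← sub_le_iff_le_add, le_div_iff₀ hD]
      have := mul_le_mul_of_nonneg_right (smallGradient_le_one f εg S.x) hD.le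
      linarith [h.successes, le_abs_self Δ]
    calc (a : ℝ) ≤ 2 * |Δ| / minDecrease P LH εH + 1 := h1
      _ = 8 * |Δ| / P.η * decreaseFactor P LH * (εH ^ 3)⁻¹ + 1 := by
        rw [minDecrease]; field_simp; ring
      _ ≤ _ := by rw [successConst, add_mul]; linarith
  have hγ2 : 0 ≤ Real.log P.γ₂ := Real.log_nonneg P.one_le_γ₂
  have hγ1 : 0 < -Real.log P.γ₁ := neg_pos.2 (Real.log_neg P.γ₁_pos P.γ₁_lt)
  have hμ := minRadius_pos P hLH one_pos
  have hlog : Real.log (minRadius P LH 1) + Real.log εH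
      ≤ b * Real.log P.γ₁ + a * Real.log P.γ₂ + Real.log P.δ₀ := by
    have hγ1p := P.γ₁_pos
    have hγ2p := zero_lt_one.trans_le P.one_le_γ₂
    have h1 := Real.log_le_log (mul_pos hμ hεH)
      ((minRadius_one_mul_le P hεH hεH1).trans (h.radius_ge.trans h.radius_le))
    rwa [Real.log_mul hμ.ne' hεH.ne', Real.log_mul (by positivity) P.δ₀_pos.ne',
      Real.log_mul (by positivity) (by positivity), Real.log_pow, Real.log_pow] at h1
  have hinv : -Real.log εH ≤ (εH ^ 3)⁻¹ := by
    rw [← Real.log_inv]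
    have h1 := Real.log_le_sub_one_of_pos (inv_pos.2 hεH)
    have h2 : εH⁻¹ ≤ (εH ^ 3)⁻¹ := by
      refine inv_anti₀ hε3 ?_
      simpa using pow_le_pow_of_le_one hεH.le hεH1 (show 1 ≤ 3 by norm_num)
    linarith
  have hδμ : 0 ≤ Real.log (P.δ₀ / minRadius P LH 1) :=
    Real.log_nonneg ((one_le_div hμ).2 (min_le_left _ _))
  have hb : (b : ℝ) ≤ (successConst P LH Δ * Real.log P.γ₂
      + Real.log (P.δ₀ / minRadius P LH 1) + 1) / -Real.log P.γ₁ * (εH ^ 3)⁻¹ := by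
    rw [div_mul_eq_mul_div, le_div_iff₀ hγ1]
    have h1 := mul_le_mul_of_nonneg_right ha hγ2
    have h2 := mul_le_mul_of_nonneg_left hE1 hδμ
    rw [Real.log_div P.δ₀_pos.ne' hμ.ne'] at h2 ⊢
    linarith
  rw [iterationConst, add_mul, add_mul, one_mul]
  linarith

/-- The number of completed iterations is finite and at most of order `ε_H⁻³`. -/
lemma Run.exists_len_eq {R : Run f P εg εH x₀} {flow Cmeo Δ : ℝ} {Lg : ℝ≥0}
    (hR : R.ObjectiveAssumption flow Lg LH) (hO : R.OracleAssumption Cmeo) (hLH : 0 < LH)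
    (hεH : 0 < εH) (hεH1 : εH ≤ 1) (hεg : εg = εH ^ 2) (hΔ : f x₀ - flow ≤ Δ) :
    ∃ N : ℕ, R.len = N ∧ (N : ℝ) + 1 ≤ iterationConst P LH Δ * (εH ^ 3)⁻¹ := by
  have hbound : ∀ k : ℕ, (k : ℕ∞) ≤ R.len →
      (k : ℝ) + 1 ≤ iterationConst P LH Δ * (εH ^ 3)⁻¹ := by
    intro k hk
    obtain ⟨a, b, o, rfl, h, -⟩ := R.exists_progress hR hO hLH hεH hεH1 hεg hk
    push_cast
    exact h.add_one_le hLH hεH hεH1 (hR.lower _ hk) hΔ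
  cases hlen : R.len with
  | top =>
    have := hbound ⌈iterationConst P LH Δ * (εH ^ 3)⁻¹⌉₊ (by simp [hlen])
    linarith [Nat.le_ceil (iterationConst P LH Δ * (εH ^ 3)⁻¹)]
  | coe N => exact ⟨N, rfl, hbound N hlen.ge⟩

end Counting

/-! ### Complexity bounds in terms of the tolerance -/

section Complexity

/-- The constant in the bound on the iteration limit of capped CG. -/
noncomputable def capConst (P : Params) : ℝ :=
  1 / 2 * √(P.M + 2) * (|Real.log (4 * (P.M + 2) ^ (3 / 2 : ℝ) / P.ζ)| + 1) + 1

lemma one_le_capConst (P : Params) : 1 ≤ capConst P := by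
  rw [capConst]
  exact le_add_of_nonneg_left (by positivity)

/-- `⌈J⌉` is of order `ε_H^{-1/2}` up to a logarithmic factor. -/
lemma ceil_capJ_le {P : Params} {εH : ℝ} (hM : 0 < P.M) (hεH : 0 < εH) (hεH1 : εH ≤ 1) :
    (⌈capJ P.M εH P.ζ⌉₊ : ℝ)
      ≤ capConst P * (1 + |Real.log (εH ^ 3)⁻¹|) * εH ^ (-(1 / 2) : ℝ) := by
  set l := Real.log (4 * (P.M + 2) ^ (3 / 2 : ℝ) / P.ζ) with hl
  set X := εH ^ (-(1 / 2) : ℝ) with hX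
  set Λ := 1 + |Real.log (εH ^ 3)⁻¹| with hΛ
  have hζ := P.ζ_pos
  have hM2 : 0 < P.M + 2 := by linarith
  have hX1 : 1 ≤ X := Real.one_le_rpow_of_pos_of_le_one_of_nonpos hεH hεH1 (by norm_num)
  have hΛ1 : 1 ≤ Λ := le_add_of_nonneg_right (abs_nonneg _)
  have hκ0 : 0 < kappa P.M εH := by rw [kappa]; positivity
  have hκ : kappa P.M εH ≤ (P.M + 2) / εH := by
    rw [kappa]
    gcongr
    linarith
  have hsqrt : √(kappa P.M εH) ≤ √(P.M + 2) * X := by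
    refine (Real.sqrt_le_sqrt hκ).trans (le_of_eq ?_)
    rw [Real.sqrt_div hM2.le, hX, Real.rpow_neg hεH.le, ← Real.sqrt_eq_rpow, div_eq_mul_inv]
  have hlogε : Real.log εH ≤ 0 := Real.log_nonpos hεH.le hεH1
  have hlogE : Real.log (εH ^ 3)⁻¹ = -3 * Real.log εH := by
    rw [Real.log_inv, Real.log_pow]
    push_cast
    ring
  have hlog : Real.log (4 * kappa P.M εH ^ (3 / 2 : ℝ) / P.ζ) ≤ (|l| + 1) * Λ := by
    have h1 : Real.log (4 * kappa P.M εH ^ (3 / 2 : ℝ) / P.ζ)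
        ≤ Real.log (4 * ((P.M + 2) / εH) ^ (3 / 2 : ℝ) / P.ζ) := by
      refine Real.log_le_log (by positivity) ?_
      gcongr
    have h2 : Real.log (4 * ((P.M + 2) / εH) ^ (3 / 2 : ℝ) / P.ζ) = l - 3 / 2 * Real.log εH := by
      rw [Real.div_rpow hM2.le hεH.le, ← mul_div_assoc, div_right_comm,
        Real.log_div (by positivity) (by positivity), Real.log_rpow hεH]
    have h3 : |Real.log (εH ^ 3)⁻¹| = -3 * Real.log εH := by
      rw [hlogE, abs_of_nonneg (by linarith)]
    have h4 := mul_nonneg (abs_nonneg l) (abs_nonneg (Real.log (εH ^ 3)⁻¹))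
    rw [h3] at h4
    rw [hΛ, h3]
    linarith [le_abs_self l]
  have hJ : capJ P.M εH P.ζ ≤ 1 / 2 * √(P.M + 2) * (|l| + 1) * Λ * X := by
    rw [capJ]
    calc 1 / 2 * √(kappa P.M εH) * Real.log (4 * kappa P.M εH ^ (3 / 2 : ℝ) / P.ζ)
        ≤ 1 / 2 * √(kappa P.M εH) * ((|l| + 1) * Λ) :=
          mul_le_mul_of_nonneg_left hlog (by positivity)
      _ ≤ 1 / 2 * (√(P.M + 2) * X) * ((|l| + 1) * Λ) := by gcongr
      _ = _ := by ring
  have h0 : 0 ≤ 1 / 2 * √(P.M + 2) * (|l| + 1) * Λ * X := by positivity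
  have hceil : (⌈capJ P.M εH P.ζ⌉₊ : ℝ) ≤ 1 / 2 * √(P.M + 2) * (|l| + 1) * Λ * X + 1 :=
    (Nat.cast_le.2 (Nat.ceil_mono hJ)).trans (Nat.ceil_lt_add_one h0).le
  have hΛX : 1 ≤ Λ * X := one_le_mul_of_one_le_of_one_le hΛ1 hX1
  rw [capConst, ← hl]
  linarith

lemma min_mul_le_mul_min {m c X : ℝ} (hm : 0 ≤ m) (hc : 1 ≤ c) :
    min m (c * X) ≤ c * min m X := by
  rw [mul_min_of_nonneg _ _ (zero_le_one.trans hc)]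
  exact min_le_min_right _ (le_mul_of_one_le_left hm hc)

lemma Nmeo_le {n : ℕ} {Cmeo εH : ℝ} (hC : 0 ≤ Cmeo) (hεH : 0 < εH) (hεH1 : εH ≤ 1) :
    (Nmeo n Cmeo εH : ℝ) ≤ (2 + Cmeo) * min (n : ℝ) (εH ^ (-(1 / 2) : ℝ)) := by
  have hX1 : 1 ≤ εH ^ (-(1 / 2) : ℝ) :=
    Real.one_le_rpow_of_pos_of_le_one_of_nonpos hεH hεH1 (by norm_num)
  refine le_trans ?_ (min_mul_le_mul_min n.cast_nonneg (by linarith))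
  rw [Nmeo, Nat.cast_min]
  refine min_le_min_left _ ?_
  push_cast
  have := Nat.ceil_lt_add_one (mul_nonneg hC (zero_le_one.trans hX1))
  linarith

lemma KbarS_le {P : Params} {LH : ℝ≥0} {Δ Δ' εg εH : ℝ} (hεH : 0 < εH) (hεH1 : εH ≤ 1)
    (hεg : εg = εH ^ 2) (hΔ : Δ' ≤ Δ) :
    (KbarS P LH Δ' εg εH : ℝ) ≤ successConst P LH Δ * (εH ^ 3)⁻¹ := by
  have hQ := decreaseFactor_pos P LH
  have hη := P.η_pos
  have hE1 : 1 ≤ (εH ^ 3)⁻¹ := (one_le_inv₀ (pow_pos hεH 3)).2 (pow_le_one₀ hεH.le hεH1)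
  -- With `ε_g = ε_H²` the three terms of the maximum are at most `ε_H⁻³`.
  have hmax : max (max εH⁻¹ ((εg ^ 2)⁻¹ * εH)) (εH ^ 3)⁻¹ = (εH ^ 3)⁻¹ := by
    refine max_eq_right (max_le ?_ (le_of_eq ?_))
    · refine inv_anti₀ (pow_pos hεH 3) ?_
      simpa using pow_le_pow_of_le_one hεH.le hεH1 (show 1 ≤ 3 by norm_num)
    · rw [hεg]
      field_simp
  have hle : CbarS P LH Δ' * (εH ^ 3)⁻¹
      ≤ 8 * |Δ| / P.η * decreaseFactor P LH * (εH ^ 3)⁻¹ := by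
    have : CbarS P LH Δ' = 8 * Δ' / P.η * decreaseFactor P LH := rfl
    rw [this]
    gcongr
    exact hΔ.trans (le_abs_self Δ)
  rw [KbarS, hmax]
  push_cast
  have h1 : (⌊CbarS P LH Δ' * (εH ^ 3)⁻¹⌋₊ : ℝ)
      ≤ 8 * |Δ| / P.η * decreaseFactor P LH * (εH ^ 3)⁻¹ :=
    (Nat.cast_le.2 (Nat.floor_mono hle)).trans (Nat.floor_le (by positivity))
  rw [successConst, add_mul]
  linarith

end Complexity

end TRNewtonCG

theorem mainTheorem3 (P : Params) (Lg LH : ℝ≥0) (hLg : 0 < Lg) (hLH : 0 < LH)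
    (hM : (Lg : ℝ) ≤ P.M) (Δ : ℝ) :
    ∃ C c : ℝ, 0 < C ∧ 0 < c ∧
      ∀ (n : ℕ) (f : Vec n → ℝ) (x₀ : Vec n) (flow Cmeo εg εH : ℝ),
        f x₀ - flow ≤ Δ → 0 ≤ Cmeo → 0 < εg → εg < 1 → εH = εg ^ (1 / 2 : ℝ) →
        ∀ R : Run f P εg εH x₀,
          R.ObjectiveAssumption flow Lg LH → R.OracleAssumption Cmeo →
          ∃ N : ℕ, R.len = (N : ℕ∞) ∧
            (P.capCG = false →
              R.products N ≤ n * (N + 1) + Nmeo n Cmeo εH * KbarS P LH (f x₀ - flow) εg εH ∧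
              (n : ℝ) * (N + 1) + Nmeo n Cmeo εH * KbarS P LH (f x₀ - flow) εg εH
                ≤ n * softO C c (εg ^ (-(3 / 2) : ℝ))) ∧
            (P.capCG = true →
              R.products N ≤ min n ⌈capJ P.M εH P.ζ⌉₊ * (N + 1)
                + Nmeo n Cmeo εH * KbarS P LH (f x₀ - flow) εg εH ∧
              (min (n : ℝ) ⌈capJ P.M εH P.ζ⌉₊) * (N + 1)
                + Nmeo n Cmeo εH * KbarS P LH (f x₀ - flow) εg εH
                ≤ min (n : ℝ) (εg ^ (-(1 / 4) : ℝ))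
                    * softO (C * (1 + Cmeo)) c (εg ^ (-(3 / 2) : ℝ)) ∧
              (R.products N : ℝ) ≤ softO (C * (1 + Cmeo)) c (εg ^ (-(7 / 4) : ℝ))) := by
  have hM0 : 0 < P.M := lt_of_lt_of_le hLg hM
  have hB := one_le_capConst P
  have hC1 := one_le_iterationConst P hLH Δ
  have hC2 := one_le_successConst P LH Δ
  set B := capConst P
  set C₁ := iterationConst P LH Δ
  set C₂ := successConst P LH Δ
  refine ⟨B * C₁ + 2 * C₂, 1, by positivity, one_pos, ?_⟩
  intro n f x₀ flow Cmeo εg εH hΔ hCmeo hεg0 hεg1 hεH R hR hO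
  have hεH0 : 0 < εH := hεH ▸ Real.rpow_pos_of_pos hεg0 _
  have hεH1 : εH ≤ 1 := hεH ▸ Real.rpow_le_one hεg0.le hεg1.le (by norm_num)
  have hεg : εg = εH ^ 2 := by
    rw [hεH, ← Real.rpow_natCast, ← Real.rpow_mul hεg0.le]
    norm_num
  have hE : εg ^ (-(3 / 2) : ℝ) = (εH ^ 3)⁻¹ := by
    rw [hεH, ← Real.rpow_natCast, ← Real.rpow_mul hεg0.le, ← Real.rpow_neg hεg0.le]
    norm_num
  have hX : εg ^ (-(1 / 4) : ℝ) = εH ^ (-(1 / 2) : ℝ) := by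
    rw [hεH, ← Real.rpow_mul hεg0.le]
    norm_num
  have hXE : εg ^ (-(7 / 4) : ℝ) = εg ^ (-(1 / 4) : ℝ) * εg ^ (-(3 / 2) : ℝ) := by
    rw [← Real.rpow_add hεg0]
    norm_num
  obtain ⟨N, hN, hNle⟩ := R.exists_len_eq hR hO hLH hεH0 hεH1 hεg hΔ
  have hK := KbarS_le (P := P) (LH := LH) hεH0 hεH1 hεg hΔ
  have hJ := ceil_capJ_le hM0 hεH0 hεH1
  have hmeo := Nmeo_le (n := n) hCmeo hεH0 hεH1
  rw [← hE] at hNle hK hJ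
  rw [← hX] at hJ hmeo
  have hE0 : 0 < εg ^ (-(3 / 2) : ℝ) := Real.rpow_pos_of_pos hεg0 _
  have hX0 : 0 < εg ^ (-(1 / 4) : ℝ) := Real.rpow_pos_of_pos hεg0 _
  have hlog : |Real.log (εg ^ (-(3 / 2) : ℝ))| ≤ |Real.log (εg ^ (-(7 / 4) : ℝ))| := by
    rw [Real.log_rpow hεg0, Real.log_rpow hεg0, abs_mul, abs_mul]
    exact mul_le_mul_of_nonneg_right (by norm_num) (abs_nonneg _)
  set E := εg ^ (-(3 / 2) : ℝ)
  set X := εg ^ (-(1 / 4) : ℝ)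
  set Λ := 1 + |Real.log E| with hΛ
  have hΛ1 : 1 ≤ Λ := le_add_of_nonneg_right (abs_nonneg _)
  have hn : (0 : ℝ) ≤ n := n.cast_nonneg
  refine ⟨N, hN, fun hcap => ⟨?_, ?_⟩, fun hcap => ?_⟩
  · exact Run.products_le hR hO hLH hεH0 hεH1 hεg hN (by simp [kMax, hcap])
  · have hmeo' : (Nmeo n Cmeo εH : ℝ) ≤ n := Nat.cast_le.2 (min_le_left _ _)
    rw [softO, Real.rpow_one]
    calc _ ≤ n * (C₁ * E) + n * (C₂ * E) := by gcongr
      _ = n * ((C₁ + C₂) * E * 1) := by ring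
      _ ≤ n * ((B * C₁ + 2 * C₂) * E * Λ) := by
        have : C₁ ≤ B * C₁ := le_mul_of_one_le_left (by positivity) hB
        gcongr
        linarith
  · have hprod : R.products N ≤ min n ⌈capJ P.M εH P.ζ⌉₊ * (N + 1)
        + Nmeo n Cmeo εH * KbarS P LH (f x₀ - flow) εg εH := by
      refine Run.products_le hR hO hLH hεH0 hεH1 hεg hN ?_
      simp only [kMax, hcap, if_true, Nat.cast_min]
      exact min_le_min_left _ (Nat.le_ceil _)
    have hbound : (min (n : ℝ) ⌈capJ P.M εH P.ζ⌉₊) * (N + 1)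
        + Nmeo n Cmeo εH * KbarS P LH (f x₀ - flow) εg εH
        ≤ min (n : ℝ) X * softO ((B * C₁ + 2 * C₂) * (1 + Cmeo)) 1 E := by
      have hm0 : 0 ≤ min (n : ℝ) X := le_min hn hX0.le
      have hJ' : min (n : ℝ) ⌈capJ P.M εH P.ζ⌉₊ ≤ B * Λ * min (n : ℝ) X :=
        (min_le_min_left _ hJ).trans
          (min_mul_le_mul_min hn (one_le_mul_of_one_le_of_one_le hB hΛ1))
      rw [softO, Real.rpow_one, ← hΛ]
      calc _ ≤ B * Λ * min (n : ℝ) X * (C₁ * E) + (2 + Cmeo) * min (n : ℝ) X * (C₂ * E) := by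
            gcongr
        _ = min (n : ℝ) X * E * (B * C₁ * Λ + (2 + Cmeo) * C₂ * 1) := by ring
        _ ≤ min (n : ℝ) X * E
            * (B * C₁ * (1 + Cmeo) * Λ + (2 * (1 + Cmeo)) * C₂ * Λ) := by
          have h1 : B * C₁ ≤ B * C₁ * (1 + Cmeo) :=
            le_mul_of_one_le_right (by positivity) (by linarith)
          have h2 : 2 + Cmeo ≤ 2 * (1 + Cmeo) := by linarith
          refine mul_le_mul_of_nonneg_left (add_le_add ?_ ?_) (by positivity)
          · exact mul_le_mul_of_nonneg_right h1 (by positivity)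
          · exact mul_le_mul (mul_le_mul_of_nonneg_right h2 (by positivity)) hΛ1 zero_le_one
              (by positivity)
        _ = _ := by ring
    refine ⟨hprod, hbound, ?_⟩
    calc (R.products N : ℝ) ≤ (min (n : ℝ) ⌈capJ P.M εH P.ζ⌉₊) * (N + 1)
          + Nmeo n Cmeo εH * KbarS P LH (f x₀ - flow) εg εH := by exact_mod_cast hprod
      _ ≤ min (n : ℝ) X * softO ((B * C₁ + 2 * C₂) * (1 + Cmeo)) 1 E := hbound
      _ ≤ X * softO ((B * C₁ + 2 * C₂) * (1 + Cmeo)) 1 E :=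
        mul_le_mul_of_nonneg_right (min_le_right _ _) (by rw [softO]; positivity)
      _ ≤ _ := by
        rw [hXE, softO, softO, Real.rpow_one, Real.rpow_one, hΛ.symm]
        rw [hXE] at hlog
        have h1 : Λ ≤ 1 + |Real.log (X * E)| := add_le_add le_rfl hlog
        calc X * ((B * C₁ + 2 * C₂) * (1 + Cmeo) * E * Λ)
            = (B * C₁ + 2 * C₂) * (1 + Cmeo) * (X * E) * Λ := by ring
          _ ≤ _ := mul_le_mul_of_nonneg_left h1 (by positivity)
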